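/- Let $(X,d)$ be a proper geodesic metric space with base point $o$, and let $G$ be a group acting on $X$ properly discontinuously by isometries. Let $v>0$ be such that the Poincaré series $\sum_{g\in G}e^{-s\,d(o,g.o)}$ converges for every $s>v$ (for instance, $v$ is its critical exponent). Let $x\mapsto\mu_x$ $(x\in X)$ be one of the following. (a) A $G$-invariant conformal density of dimension $v$ on the horofunction boundary $\partial X=\partial_hX$: a weakly continuous map from $X$ to the finite Borel measures on $\partial X$ with $g_*\mu_x=\mu_{g.x}$ and $\frac{d\mu_x}{d\mu_o}(\xi)=e^{-v\beta_\xi(x,o)}$, where $\beta_\xi(p,q)=h(p)-h(q)$ for a horofunction $h$ representing $\xi$. (b) If $X$ is Gromov-hyperbolic, a $G$-invariant quasiconformal density of dimension $v$ on the Gromov boundary $\partial X=\partial_gX$: a map from $X$ to the finite Borel measures on $\partial X$ with $g_*\mu_x=\mu_{g.x}$, all $\mu_x$ mutually absolutely continuous, such that for some $C\ge1$ and all $x,y\in X$, $C^{-1}e^{-v\beta_\xi(x,y)}\le\frac{d\mu_x}{d\mu_y}(\xi)\le C\,e^{-v\beta_\xi(x,y)}$ for almost every $\xi$, where $\beta_\xi(p,q)=\limsup_{z\to\xi}(d(p,z)-d(q,z))$.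 Assume that $\mu=\mu_o$ is a probability measure. For $n\in\mathbb N$ put $B_n=\{g\in G: d(o,g.o)\le n\}$, $V_n=e^{vn}$ and $$C_n=\frac1{V_n}\int\max_{g\in B_n}\frac{dg_*\mu}{d\mu}(\xi)\,d\mu(\xi).$$ Extremal cocycle growth (ECG) is called vanishing if $\lim_n C_n=0$, and non-vanishing if $\liminf_n C_n>0$. Let $0<\alpha<2$, let $\phi_g(\xi)=g^{-1}\xi$, and let $\{c_g\}_{g\in G}$ be a measurable $\pm1$-valued cocycle for $\{\phi_g\}$, that is, $c_{gh}(\xi)=c_g(\xi)\,c_h(\phi_g(\xi))$ for all $g,h\in G$ and $\mu$-almost every $\xi$. Let $\{Y_g\}_{g\in G}$ be the (stationary) symmetric $\alpha$-stable random field with Rosiński representation $f_g=c_g\left(\frac{d(\mu\circ\phi_g)}{d\mu}\right)^{1/\alpha}$: every finite linear combination $W=\sum_i a_iY_{g_i}$ has characteristic function $\mathbb E\,e^{i\theta W}=e^{-\sigma^\alpha|\theta|^\alpha}$ with $\sigma=\left(\int\left|\sum_i a_if_{g_i}\right|^\alpha d\mu\right)^{1/\alpha}$. Let $M_n=\max_{g\in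 B_n}|Y_g|$, and let $Z_\alpha$ be a Fréchet random variable, $\mathbb P(Z_\alpha\le x)=e^{-x^{-\alpha}}$ for $x>0$. (1) If ECG is non-vanishing, then every subsequence of $(M_n)$ has a further subsequence $(M_{n_k})$ such that $M_{n_k}/V_{n_k}^{1/\alpha}$ converges in distribution to $\kappa Z_\alpha$ as $k\to\infty$, for some constant $\kappa>0$ that may depend on the subsequence. If moreover $\lim_n C_n$ exists, then the whole sequence $M_n/V_n^{1/\alpha}$ converges in distribution to $\kappa Z_\alpha$ for some constant $\kappa>0$. (2) If ECG is vanishing, then $M_n/V_n^{1/\alpha}\to0$ in probability as $n\to\infty$. -/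

import Mathlib

open MeasureTheory Filter Topology
open scoped ENNReal

noncomputable section

/-! ### Geodesic and Gromov-hyperbolic metric spaces -/

/-- Any two points are joined by a geodesic segment. -/
def IsGeodesicSpace (X : Type*) [MetricSpace X] : Prop :=
  ∀ x y : X, ∃ γ : ℝ → X, γ 0 = x ∧ γ (dist x y) = y ∧
    ∀ s ∈ Set.Icc 0 (dist x y), ∀ t ∈ Set.Icc 0 (dist x y), dist (γ s) (γ t) = |s - t|

/-- The Gromov product `(x | y)_w`. -/
def gromovProduct {X : Type*} [MetricSpace X] (w x y : X) : ℝ :=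
  (dist x w + dist y w - dist x y) / 2

/-- Gromov hyperbolicity (four-point condition). -/
def IsGromovHyperbolic (X : Type*) [MetricSpace X] : Prop :=
  ∃ δ : ℝ, ∀ w x y z : X,
    min (gromovProduct w x y) (gromovProduct w y z) - δ ≤ gromovProduct w x z

/-! ### The horofunction boundary -/

/-- The constant functions, as a subgroup of `C(X, ℝ)`. -/
def constFunctions (X : Type*) [TopologicalSpace X] : AddSubgroup C(X, ℝ) where
  carrier := {f | ∃ c : ℝ, ∀ x, f x = c}
  zero_mem' := ⟨0, fun _ => rfl⟩
  add_mem' := by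
    rintro f h ⟨a, ha⟩ ⟨b, hb⟩
    exact ⟨a + b, fun x => by simp [ha x, hb x]⟩
  neg_mem' := by
    rintro f ⟨a, ha⟩
    exact ⟨-a, fun x => by simp [ha x]⟩

/-- Continuous functions modulo constants; `C(X, ℝ)` carries the topology of uniform convergence
on compact sets, and the quotient the quotient topology. -/
def HoroSpace (X : Type*) [MetricSpace X] : Type _ := C(X, ℝ) ⧸ constFunctions X

instance (X : Type*) [MetricSpace X] : TopologicalSpace (HoroSpace X) :=
  inferInstanceAs (TopologicalSpace (C(X, ℝ) ⧸ constFunctions X))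

namespace HoroSpace

variable {X : Type*} [MetricSpace X]

/-- The class of a continuous function. -/
def mk (f : C(X, ℝ)) : HoroSpace X := QuotientAddGroup.mk f

theorem mk_eq_mk {f h : C(X, ℝ)} : mk f = mk h ↔ ∃ c : ℝ, ∀ x, h x = f x + c := by
  refine (QuotientAddGroup.eq (s := constFunctions X)).trans ?_
  constructor
  · rintro ⟨c, hc⟩
    refine ⟨c, fun x => ?_⟩
    have := hc x
    simp only [ContinuousMap.add_apply, ContinuousMap.neg_apply] at this
    linarith
  · rintro ⟨c, hc⟩
    exact ⟨c, fun x => by simp [hc x]⟩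

theorem continuous_mk : Continuous (mk : C(X, ℝ) → HoroSpace X) := continuous_quotient_mk'

theorem continuous_of_comp_mk {Y : Type*} [TopologicalSpace Y] {F : HoroSpace X → Y}
    (h : Continuous (F ∘ mk)) : Continuous F :=
  continuous_quot_lift (r := (QuotientAddGroup.leftRel (constFunctions X)).r)
    (f := F ∘ mk) (fun _ _ hab => congrArg F (Quot.sound hab)) h |>.congr
      (fun q => Quot.inductionOn q fun _ => rfl)

/-- The difference `h p - h q` of the values of a function known up to an additive constant. -/
def diff (η : HoroSpace X) (p q : X) : ℝ :=
  Quotient.liftOn' η (fun h : C(X, ℝ) => h p - h q) (by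
    intro f h hfh
    obtain ⟨c, hc⟩ := mk_eq_mk.1 (Quotient.sound' hfh : mk f = mk h)
    simp only [hc]
    ring)

/-- The map `x ↦ d(x, ·)`, modulo constants. -/
def embed (x : X) : HoroSpace X := mk ⟨fun y => dist x y, by fun_prop⟩

variable {G : Type*} [Group G] [MulAction G X] [IsIsometricSMul G X]

/-- The function `h ∘ g⁻¹`. -/
def translateFun (g : G) (h : C(X, ℝ)) : C(X, ℝ) :=
  h.comp ⟨fun x => g⁻¹ • x, continuous_const_smul g⁻¹⟩

/-- Isometries act by `g • [h] = [h ∘ g⁻¹]`. -/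
instance : MulAction G (HoroSpace X) where
  smul g η := Quotient.liftOn' η (fun h => mk (translateFun g h)) (by
    intro f h hfh
    obtain ⟨c, hc⟩ := mk_eq_mk.1 (Quotient.sound' hfh : mk f = mk h)
    exact mk_eq_mk.2 ⟨c, fun x => hc (g⁻¹ • x)⟩)
  one_smul η := by
    induction η using Quotient.inductionOn' with
    | h f => exact congrArg mk (ContinuousMap.ext fun x => by simp [translateFun])
  mul_smul g k η := by
    induction η using Quotient.inductionOn' with
    | h f => exact congrArg mk (ContinuousMap.ext fun x => by simp [translateFun, mul_smul])

theorem smul_mk (g : G) (h : C(X, ℝ)) : g • mk h = mk (translateFun g h) := rfl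

theorem smul_embed (g : G) (x : X) : g • embed x = embed (g • x) := by
  refine congrArg mk (ContinuousMap.ext fun y => ?_)
  change dist x (g⁻¹ • y) = dist (g • x) y
  rw [← dist_smul g x (g⁻¹ • y), smul_inv_smul]

theorem diff_smul (g : G) (η : HoroSpace X) (p q : X) :
    (g • η).diff p q = η.diff (g⁻¹ • p) (g⁻¹ • q) := by
  induction η using Quotient.inductionOn' with
  | h f => rfl

instance : ContinuousConstSMul G (HoroSpace X) where
  continuous_const_smul _ :=
    continuous_of_comp_mk (continuous_mk.comp (ContinuousMap.continuous_precomp _))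

end HoroSpace

/-- The horofunction boundary, as a set: the closure of the image of `X`, minus that image. -/
def horoBoundarySet (X : Type*) [MetricSpace X] : Set (HoroSpace X) :=
  closure (Set.range HoroSpace.embed) \ Set.range HoroSpace.embed

/-- The horofunction boundary, with the subspace topology and its Borel σ-algebra. -/
def HoroBoundary (X : Type*) [MetricSpace X] : Type _ := horoBoundarySet X

instance (X : Type*) [MetricSpace X] : TopologicalSpace (HoroBoundary X) :=
  inferInstanceAs (TopologicalSpace (horoBoundarySet X))

instance (X : Type*) [MetricSpace X] : MeasurableSpace (HoroBoundary X) := borel _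

instance (X : Type*) [MetricSpace X] : BorelSpace (HoroBoundary X) := ⟨rfl⟩

namespace HoroBoundary

variable {X : Type*} [MetricSpace X]

/-- The underlying horofunction, modulo constants. -/
def toHoroSpace (ξ : HoroBoundary X) : HoroSpace X := ξ.1

/-- The Busemann cocycle `β_ξ(p, q) = h p - h q` of the horofunction `h` representing `ξ`:
if `z → ξ` then `d(p, z) - d(q, z) → β_ξ(p, q)`. -/
def busemann (ξ : HoroBoundary X) (p q : X) : ℝ := ξ.toHoroSpace.diff p q

variable {G : Type*} [Group G] [MulAction G X] [IsIsometricSMul G X]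

theorem smul_mem (g : G) {η : HoroSpace X} (h : η ∈ horoBoundarySet X) :
    g • η ∈ horoBoundarySet X := by
  refine ⟨?_, ?_⟩
  · refine map_mem_closure (continuous_const_smul g) h.1 ?_
    rintro _ ⟨x, rfl⟩
    exact ⟨g • x, (HoroSpace.smul_embed g x).symm⟩
  · rintro ⟨x, hx⟩
    refine h.2 ⟨g⁻¹ • x, ?_⟩
    rw [← HoroSpace.smul_embed, hx, inv_smul_smul]

instance : MulAction G (HoroBoundary X) where
  smul g ξ := ⟨g • ξ.1, smul_mem g ξ.2⟩
  one_smul ξ := Subtype.ext (one_smul G ξ.1)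
  mul_smul g k ξ := Subtype.ext (mul_smul g k ξ.1)

theorem busemann_smul (g : G) (ξ : HoroBoundary X) (p q : X) :
    (g • ξ).busemann p q = ξ.busemann (g⁻¹ • p) (g⁻¹ • q) :=
  HoroSpace.diff_smul g ξ.1 p q

end HoroBoundary

/-! ### The Gromov boundary -/

/-- Two horofunctions are equivalent if they differ by a bounded function. -/
def gromovSetoid (X : Type*) [MetricSpace X] : Setoid (HoroBoundary X) where
  r ξ η := ∃ K : ℝ, ∀ p q : X, |ξ.busemann p q - η.busemann p q| ≤ K
  iseqv :=
    { refl := fun ξ => ⟨0, fun p q => by simp⟩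
      symm := fun ⟨K, h⟩ => ⟨K, fun p q => by rw [abs_sub_comm]; exact h p q⟩
      trans := fun ⟨K, h⟩ ⟨L, k⟩ => ⟨K + L, fun p q =>
        (abs_sub_le _ _ _).trans (add_le_add (h p q) (k p q))⟩ }

/-- The Gromov boundary of a proper geodesic Gromov-hyperbolic space, as the quotient of the
horofunction boundary by bounded functions, with its Borel σ-algebra. -/
def GromovBoundary (X : Type*) [MetricSpace X] : Type _ := Quotient (gromovSetoid X)

instance (X : Type*) [MetricSpace X] : TopologicalSpace (GromovBoundary X) :=
  inferInstanceAs (TopologicalSpace (Quotient (gromovSetoid X)))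

instance (X : Type*) [MetricSpace X] : MeasurableSpace (GromovBoundary X) := borel _

instance (X : Type*) [MetricSpace X] : BorelSpace (GromovBoundary X) := ⟨rfl⟩

namespace GromovBoundary

variable {X : Type*} [MetricSpace X]

/-- The projection from the horofunction boundary. -/
def proj (ξ : HoroBoundary X) : GromovBoundary X := Quotient.mk (gromovSetoid X) ξ

/-- The filter on `X` of convergence `z → ξ`: in the horofunction compactification, `z` approaches
the set of all horofunctions in the class `ξ`. -/
def approach (ξ : GromovBoundary X) : Filter X :=
  comap HoroSpace.embed (𝓝ˢ (HoroBoundary.toHoroSpace '' (proj ⁻¹' {ξ})))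

/-- `β_ξ(p, q) = limsup_{z → ξ} (d(p, z) - d(q, z))`. -/
def busemann (ξ : GromovBoundary X) (p q : X) : ℝ :=
  limsup (fun z => dist p z - dist q z) ξ.approach

variable {G : Type*} [Group G] [MulAction G X] [IsIsometricSMul G X]

instance : MulAction G (GromovBoundary X) where
  smul g := Quotient.map (g • ·) (by
    rintro ξ η ⟨K, h⟩
    refine ⟨K, fun p q => ?_⟩
    simp only [HoroBoundary.busemann_smul]
    exact h _ _)
  one_smul ξ := by
    induction ξ using Quotient.inductionOn with
    | h a => exact congrArg proj (one_smul G a)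
  mul_smul g k ξ := by
    induction ξ using Quotient.inductionOn with
    | h a => exact congrArg proj (mul_smul g k a)

end GromovBoundary

/-! ### Conformal and quasiconformal densities -/

/-- A `G`-invariant conformal density of dimension `v` on the horofunction boundary. -/
structure IsConformalDensity (G : Type*) {X : Type*} [MetricSpace X] [Group G] [MulAction G X]
    [IsIsometricSMul G X] (o : X) (v : ℝ) (μ : X → FiniteMeasure (HoroBoundary X)) : Prop where
  continuous : Continuous μ
  equivariant : ∀ (g : G) (x : X),
    (μ (g • x) : Measure (HoroBoundary X)) = (μ x : Measure (HoroBoundary X)).map (g • ·)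
  density : ∀ x : X, (μ x : Measure (HoroBoundary X)) =
    (μ o : Measure (HoroBoundary X)).withDensity
      fun ξ => ENNReal.ofReal (Real.exp (-v * ξ.busemann x o))

/-- A `G`-invariant `C`-quasiconformal density of dimension `v` on the Gromov boundary. -/
structure IsQuasiconformalDensity (G : Type*) {X : Type*} [MetricSpace X] [Group G] [MulAction G X]
    [IsIsometricSMul G X] (v C : ℝ) (μ : X → FiniteMeasure (GromovBoundary X)) : Prop where
  equivariant : ∀ (g : G) (x : X),
    (μ (g • x) : Measure (GromovBoundary X)) = (μ x : Measure (GromovBoundary X)).map (g • ·)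
  absolutelyContinuous : ∀ x y : X,
    (μ x : Measure (GromovBoundary X)) ≪ (μ y : Measure (GromovBoundary X))
  density : ∀ x y : X, ∀ᵐ ξ ∂(μ y : Measure (GromovBoundary X)),
    ENNReal.ofReal (C⁻¹ * Real.exp (-v * ξ.busemann x y)) ≤
        (μ x : Measure (GromovBoundary X)).rnDeriv (μ y) ξ ∧
      (μ x : Measure (GromovBoundary X)).rnDeriv (μ y) ξ ≤
        ENNReal.ofReal (C * Real.exp (-v * ξ.busemann x y))

/-! ### Extremal cocycle growth -/

section ECG

variable (G : Type*) {X : Type*} [MetricSpace X] [Group G] [MulAction G X]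

/-- `B_n`, the group elements that move the base point by at most `n`. -/
def orbitBall (o : X) (n : ℕ) : Set G := {g | dist o (g • o) ≤ n}

/-- `V_n = exp (v n)`. -/
def volGrowth (v : ℝ) (n : ℕ) : ℝ := Real.exp (v * n)

variable {Λ : Type*} [MeasurableSpace Λ] [MulAction G Λ]

/-- `A_n(ξ)`, the maximum over `g ∈ B_n` of the Radon-Nikodym derivative of `g_* μ` with respect
to `μ` at `ξ`. -/
def maxCocycle (o : X) (μ : Measure Λ) (n : ℕ) (ξ : Λ) : ℝ≥0∞ :=
  ⨆ g ∈ orbitBall G o n, (μ.map (g • ·)).rnDeriv μ ξ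

/-- `C_n`, the integral of `A_n` divided by `V_n`. -/
def extremalCocycle (o : X) (v : ℝ) (μ : Measure Λ) (n : ℕ) : ℝ≥0∞ :=
  (∫⁻ ξ, maxCocycle G o μ n ξ ∂μ) / ENNReal.ofReal (volGrowth v n)

/-- Vanishing extremal cocycle growth. -/
def VanishingECG (o : X) (v : ℝ) (μ : Measure Λ) : Prop :=
  Tendsto (extremalCocycle G o v μ) atTop (𝓝 0)

/-- Non-vanishing extremal cocycle growth. -/
def NonvanishingECG (o : X) (v : ℝ) (μ : Measure Λ) : Prop :=
  0 < liminf (extremalCocycle G o v μ) atTop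

end ECG

/-! ### Symmetric stable random fields -/

section Stable

variable {Ω : Type*} [MeasurableSpace Ω]

/-- `W` is symmetric `α`-stable with scale parameter `σ` (with `W = 0` a.s. allowed, for `σ = 0`). -/
def IsSymmetricStable (W : Ω → ℝ) (P : Measure Ω) (α σ : ℝ) : Prop :=
  AEMeasurable W P ∧
    ∀ θ : ℝ, charFun (P.map W) θ = ((Real.exp (-(σ ^ α * |θ| ^ α)) : ℝ) : ℂ)

variable {G : Type*} [Group G] {Λ : Type*} [MeasurableSpace Λ] [MulAction G Λ]

/-- A measurable `±1`-valued cocycle for the maps `φ_g ξ = g⁻¹ • ξ`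
(which satisfy `φ_{gh} = φ_h ∘ φ_g`). -/
structure IsSignCocycle (μ : Measure Λ) (c : G → Λ → ℝ) : Prop where
  measurable : ∀ g, Measurable (c g)
  sign : ∀ g ξ, c g ξ = 1 ∨ c g ξ = -1
  cocycle : ∀ g h : G, ∀ᵐ ξ ∂μ, c (g * h) ξ = c g ξ * c h (g⁻¹ • ξ)

/-- `f_g = c_g (d(μ ∘ φ_g)/dμ)^{1/α}`, for `φ_g ξ = g⁻¹ • ξ` and the function `f = 1`;
here `μ ∘ φ_g` is the push-forward of `μ` by `g`. -/
def rosinskiKernel (α : ℝ) (μ : Measure Λ) (c : G → Λ → ℝ) (g : G) (ξ : Λ) : ℝ :=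
  c g ξ * ((μ.map (g • ·)).rnDeriv μ ξ).toReal ^ (1 / α)

/-- `Y_g = ∫ f_g dM` in law, `M` a symmetric `α`-stable random measure with control measure `μ`:
each finite linear combination `∑ a_g Y_g` is symmetric `α`-stable with scale parameter
`‖∑ a_g f_g‖_α`. -/
def HasRosinskiRepresentation (α : ℝ) (μ : Measure Λ) (c : G → Λ → ℝ) (P : Measure Ω)
    (Y : G → Ω → ℝ) : Prop :=
  ∀ (s : Finset G) (a : G → ℝ),
    IsSymmetricStable (fun ω => ∑ g ∈ s, a g * Y g ω) P α
      ((∫ ξ, |∑ g ∈ s, a g * rosinskiKernel α μ c g ξ| ^ α ∂μ) ^ (1 / α))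

/-- `Z` has the standard Fréchet distribution of index `α`: `P (Z ≤ x) = exp (-x^{-α})` for
`x > 0`, and `P (Z ≤ 0) = 0`. -/
def IsFrechet (Z : Ω → ℝ) (P : Measure Ω) (α : ℝ) : Prop :=
  AEMeasurable Z P ∧ ∀ x : ℝ, P.map Z (Set.Iic x) =
    if 0 < x then ENNReal.ofReal (Real.exp (-x ^ (-α))) else 0

variable {X : Type*} [MetricSpace X] [MulAction G X]

/-- `M_n`, the maximum of `|Y_g|` over `g ∈ B_n`. -/
def partialMax (o : X) (Y : G → Ω → ℝ) (n : ℕ) (ω : Ω) : ℝ :=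
  ⨆ g : orbitBall G o n, |Y g ω|

/-- `M_n / V_n^{1/α}`. -/
def scaledMax (o : X) (v α : ℝ) (Y : G → Ω → ℝ) (n : ℕ) (ω : Ω) : ℝ :=
  partialMax o Y n ω / volGrowth v n ^ (1 / α)

variable (G) in
/-- The dichotomy for the partial maxima `M_n` of the field `Y`, where `Z` is a Fréchet variable. -/
def MaximaDichotomy (o : X) (v α : ℝ) (μ : Measure Λ)
    (P : Measure Ω) [IsProbabilityMeasure P] (Y : G → Ω → ℝ)
    {Ω' : Type*} [MeasurableSpace Ω'] (P' : Measure Ω') [IsProbabilityMeasure P']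
    (Z : Ω' → ℝ) : Prop :=
  (NonvanishingECG G o v μ →
    (∀ φ : ℕ → ℕ, StrictMono φ → ∃ ψ : ℕ → ℕ, StrictMono ψ ∧ ∃ κ : ℝ, 0 < κ ∧
      TendstoInDistribution (fun k => scaledMax o v α Y (φ (ψ k))) atTop
        (fun ω => κ * Z ω) (fun _ => P) P') ∧
    ((∃ L : ℝ≥0∞, Tendsto (extremalCocycle G o v μ) atTop (𝓝 L)) →
      ∃ κ : ℝ, 0 < κ ∧
        TendstoInDistribution (scaledMax o v α Y) atTop
          (fun ω => κ * Z ω) (fun _ => P) P')) ∧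
  (VanishingECG G o v μ →
    TendstoInMeasure P (scaledMax o v α Y) atTop (fun _ => (0 : ℝ)))

end Stable

end

/-! The maximum of a stable vector is decided by its single largest jump. For fixed `n`, the vector
of all `Y g` with `g` in `B_n` is the weak limit, as `N → ∞`, of a sum of `N` independent vectors `r
• f(u)`, where `(u, r)` has law `μ ⊗ ν` with small `r` cut off, and `ν` is the stable Lévy measure
(`tendsto_law_jumpSum`). For individual jumps the maximum is explicit: by independence, the
probability that no coordinate of any jump exceeds `a` is an `N`-th power, with limit `exp(-k a^{-α}
∫ max |f_g|^α dμ)` (`tendsto_jumpLaw_pow`). Since `|f_g|^α` is the Radon-Nikodym derivative of `g_*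
μ`, at level `a = x V_n^{1/α}` the exponent becomes `-k x^{-α} C_n`. This is how extremal cocycle
growth enters.

Sums and individual jumps are compared at a level `τ`. In a given coordinate, if at most one jump
exceeds `τ` and the remaining ones add up to less than `4τ`, then the sum differs from the largest
jump by a bounded multiple of `τ`. With `τ = ε V_n^{1/α}`, two large jumps have probability
`O(V_n^{-2})`, and a Chernoff bound for the truncated sum also gives `O(V_n^{-2})`. A union bound
over coordinates multiplies this by the cardinality of `B_n`, which is `o(V_n^2)` because the
Poincaré series converges for some exponent below `2v` (`tendsto_ncard_orbitBall`). Thus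
`stable_max_bounds` and `scaledMax_bounds` determine the distribution function of the scaled maximum
up to a vanishing error and a shift by `4ε`.

Finally `C_n` is bounded, because Busemann cocycles satisfy `β(p, q) ≥ -d(p, q)`. Along any sequence
where `C_n → L`, the distribution functions converge at each `x > 0` to `exp(-k L x^{-α})`: a
Fréchet law with `κ = (k L)^{1/α}` if `L > 0`, the point mass at `0` if `L = 0`. -/

/-! ### The symmetric stable Lévy measure -/

/-- `ν` is the Lévy measure of the symmetric `α`-stable law with characteristic function
`exp (-|s| ^ α)`; `k` is the tail constant, `K` bounds the truncated second moments. -/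
structure IsStableLevyMeasure (α k K : ℝ) (ν : Measure ℝ) : Prop where
  tail : ∀ x : ℝ, 0 < x → ν {r | x < |r|} = ENNReal.ofReal (k * x ^ (-α))
  truncated : ∀ y : ℝ, 0 < y →
    ∫⁻ r in {r | |r| ≤ y}, ENNReal.ofReal (r ^ 2) ∂ν ≤ ENNReal.ofReal (K * y ^ (2 - α))
  map_neg : ν.map Neg.neg = ν
  cosine : ∀ s : ℝ, ∫⁻ r, ENNReal.ofReal (1 - Real.cos (s * r)) ∂ν = ENNReal.ofReal (|s| ^ α)

/-- The odd function `t ↦ sign t * |t| ^ (-1 / α)`. -/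
noncomputable def signedRpow (α t : ℝ) : ℝ := t * |t| ^ (-(1 + 1 / α))

theorem measurable_signedRpow (α : ℝ) : Measurable (signedRpow α) := by
  unfold signedRpow; fun_prop

theorem signedRpow_neg (α t : ℝ) : signedRpow α (-t) = -signedRpow α t := by
  simp [signedRpow]

theorem abs_signedRpow (α : ℝ) {t : ℝ} (ht : t ≠ 0) : |signedRpow α t| = |t| ^ (-(1 / α)) := by
  have h : 0 < |t| := abs_pos.2 ht
  rw [signedRpow, abs_mul, abs_of_nonneg (Real.rpow_nonneg h.le _)]
  nth_rewrite 1 [← Real.rpow_one |t|]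
  rw [← Real.rpow_add h]
  ring_nf

theorem signedRpow_mul (α : ℝ) {c : ℝ} (hc : 0 < c) (t : ℝ) :
    signedRpow α (c * t) = c ^ (-(1 / α)) * signedRpow α t := by
  have : c ^ (-(1 / α)) = c * c ^ (-(1 + 1 / α)) := by
    nth_rewrite 2 [← Real.rpow_one c]
    rw [← Real.rpow_add hc]
    ring_nf
  rw [signedRpow, signedRpow, abs_mul, abs_of_pos hc, Real.mul_rpow hc.le (abs_nonneg t), this]
  ring

/-- The unnormalised stable Lévy measure. -/
noncomputable def rawLevyMeasure (α : ℝ) : Measure ℝ := (volume : Measure ℝ).map (signedRpow α)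

instance (α : ℝ) : SFinite (rawLevyMeasure α) := by
  unfold rawLevyMeasure; infer_instance

theorem rawLevyMeasure_map_neg (α : ℝ) : (rawLevyMeasure α).map Neg.neg = rawLevyMeasure α := by
  unfold rawLevyMeasure
  rw [Measure.map_map measurable_neg (measurable_signedRpow α)]
  have : Neg.neg ∘ signedRpow α = signedRpow α ∘ Neg.neg := by
    funext t; simp [signedRpow_neg]
  rw [this, ← Measure.map_map (measurable_signedRpow α) measurable_neg]
  congr 1
  exact Measure.map_neg_eq_self volume

/-- Dilating `r` by `c` amounts to dilating the Lebesgue variable `t` by `c ^ (-α)`. This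
self-similarity reduces the truncated moments and the cosine integral to the case of scale one. -/
theorem lintegral_rawLevyMeasure_scale {α : ℝ} (hα : 0 < α) {c : ℝ} (hc : 0 < c)
    {g : ℝ → ℝ≥0∞} (hg : Measurable g) :
    ∫⁻ r, g (c * r) ∂(rawLevyMeasure α) =
      ENNReal.ofReal (c ^ α) * ∫⁻ r, g r ∂(rawLevyMeasure α) := by
  unfold rawLevyMeasure
  rw [lintegral_map (by fun_prop) (measurable_signedRpow α),
    lintegral_map hg (measurable_signedRpow α)]
  have hb : 0 < c ^ (-α) := Real.rpow_pos_of_pos hc _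
  have h1 : ∀ t, g (c * signedRpow α t) = g (signedRpow α (c ^ (-α) * t)) := by
    intro t
    rw [signedRpow_mul α hb, ← Real.rpow_mul hc.le]
    congr 2
    rw [show -α * -(1 / α) = 1 by field_simp, Real.rpow_one]
  simp_rw [h1]
  have h2 := Real.map_volume_mul_left hb.ne'
  have h3 : ∫⁻ t, g (signedRpow α (c ^ (-α) * t)) =
      ∫⁻ t, g (signedRpow α t) ∂((volume : Measure ℝ).map (c ^ (-α) * ·)) := by
    exact (lintegral_map (hg.comp (measurable_signedRpow α)) (measurable_const_mul _)).symm
  rw [h3, h2, lintegral_smul_measure, Real.rpow_neg hc.le, inv_inv,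
    abs_of_pos (Real.rpow_pos_of_pos hc _), smul_eq_mul]

theorem rawLevyMeasure_tail {α : ℝ} (hα : 0 < α) {x : ℝ} (hx : 0 < x) :
    rawLevyMeasure α {r | x < |r|} = ENNReal.ofReal (2 * x ^ (-α)) := by
  unfold rawLevyMeasure
  rw [Measure.map_apply (measurable_signedRpow α) (measurableSet_lt measurable_const (by fun_prop))]
  have hd : 0 < x ^ (-α) := Real.rpow_pos_of_pos hx _
  -- The origin is removed because `signedRpow α 0 = 0`, although `t` near `0` gives large jumps; a
  -- point is Lebesgue-null.
  have : signedRpow α ⁻¹' {r | x < |r|} = Set.Ioo (-(x ^ (-α))) (x ^ (-α)) \ {0} := by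
    ext t
    simp only [Set.mem_preimage, Set.mem_ofPred_eq, Set.mem_sdiff, Set.mem_Ioo,
      Set.mem_singleton_iff, ← abs_lt]
    by_cases ht : t = 0
    · subst ht; simp [signedRpow, hx.le]
    · have h : 0 < |t| := abs_pos.2 ht
      rw [abs_signedRpow α ht]
      simp only [ht, not_false_eq_true, and_true]
      rw [← Real.rpow_lt_rpow_iff_of_neg (z := -α) (by positivity) hx (by linarith),
        ← Real.rpow_mul h.le, show -(1 / α) * -α = 1 by field_simp, Real.rpow_one]
  rw [this, measure_sdiff_null (by simp), Real.volume_Ioo]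
  congr 1; ring

theorem rawLevyMeasure_truncated_lt_top {α : ℝ} (hα : 0 < α) (hα₂ : α < 2) :
    ∫⁻ r in {r | |r| ≤ 1}, ENNReal.ofReal (r ^ 2) ∂(rawLevyMeasure α) < ∞ := by
  have hm : MeasurableSet {r : ℝ | |r| ≤ 1} := measurableSet_le (by fun_prop) measurable_const
  rw [← lintegral_indicator hm]
  unfold rawLevyMeasure
  rw [lintegral_map ((by fun_prop : Measurable fun r : ℝ => ENNReal.ofReal (r ^ 2)).indicator hm)
    (measurable_signedRpow α)]
  -- On `|r| ≤ 1`, that is `|t| ≥ 1` or `t = 0`, the integrand is `|t| ^ (-2/α)` or `0`. The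
  -- exponent `2/α > 1` makes this majorant integrable, and `1 + |t| ≤ 2|t|` explains the constant.
  have hint : Integrable (fun t : ℝ => (2 : ℝ) ^ (2 / α) * (1 + ‖t‖) ^ (-(2 / α))) :=
    (integrable_one_add_norm (by simp; rw [lt_div_iff₀ hα]; linarith)).const_mul _
  refine lt_of_le_of_lt (lintegral_mono fun t => ?_) hint.lintegral_lt_top
  by_cases ht : t = 0
  · subst ht; simp [signedRpow]
  have h : 0 < |t| := abs_pos.2 ht
  by_cases h1 : |signedRpow α t| ≤ 1
  · rw [Set.indicator_of_mem (show signedRpow α t ∈ {r : ℝ | |r| ≤ 1} from h1)]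
    refine ENNReal.ofReal_le_ofReal ?_
    rw [← sq_abs, abs_signedRpow α ht, Real.norm_eq_abs]
    rw [abs_signedRpow α ht] at h1
    have h2 : 1 ≤ |t| := by
      by_contra hlt
      push Not at hlt
      have := Real.one_lt_rpow_of_pos_of_lt_one_of_neg h hlt
        (show -(1 / α) < 0 by simp [hα])
      linarith
    have h3 : (|t| ^ (-(1 / α))) ^ 2 = |t| ^ (-(2 / α)) := by
      rw [← Real.rpow_natCast, ← Real.rpow_mul h.le]
      congr 1; push_cast; ring
    rw [h3]
    have h4 : (2 * |t|) ^ (-(2 / α)) ≤ (1 + |t|) ^ (-(2 / α)) :=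
      Real.rpow_le_rpow_of_nonpos (by linarith) (by linarith)
        (by simp only [Left.neg_nonpos_iff]; positivity)
    calc |t| ^ (-(2 / α)) = 2 ^ (2 / α) * (2 * |t|) ^ (-(2 / α)) := by
          rw [Real.mul_rpow (by norm_num) h.le, ← mul_assoc, ← Real.rpow_add (by norm_num)]
          simp
      _ ≤ _ := by gcongr
  · rw [Set.indicator_of_notMem (show signedRpow α t ∉ {r : ℝ | |r| ≤ 1} from h1)]
    exact zero_le

theorem rawLevyMeasure_cosine_ne_top {α : ℝ} (hα : 0 < α) (hα₂ : α < 2) :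
    ∫⁻ r, ENNReal.ofReal (1 - Real.cos r) ∂(rawLevyMeasure α) ≠ ∞ := by
  have hm : MeasurableSet {r : ℝ | |r| ≤ 1} := measurableSet_le (by fun_prop) measurable_const
  rw [← lintegral_add_compl _ hm]
  refine ENNReal.add_ne_top.2 ⟨?_, ?_⟩
  · refine ne_top_of_le_ne_top (rawLevyMeasure_truncated_lt_top hα hα₂).ne
      (lintegral_mono fun r => ENNReal.ofReal_le_ofReal ?_)
    nlinarith [Real.one_sub_sq_div_two_le_cos (x := r), sq_nonneg r]
  · have hc : {r : ℝ | |r| ≤ 1}ᶜ = {r | 1 < |r|} := by ext r; simp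
    rw [hc]
    refine ne_top_of_le_ne_top (b := ENNReal.ofReal 2 * rawLevyMeasure α {r | 1 < |r|}) ?_ ?_
    · rw [rawLevyMeasure_tail hα one_pos]
      exact ENNReal.mul_ne_top ENNReal.ofReal_ne_top ENNReal.ofReal_ne_top
    · rw [← setLIntegral_const]
      exact lintegral_mono fun r => ENNReal.ofReal_le_ofReal (by linarith [Real.neg_one_le_cos r])

theorem rawLevyMeasure_cosine_ne_zero {α : ℝ} (hα : 0 < α) :
    ∫⁻ r, ENNReal.ofReal (1 - Real.cos r) ∂(rawLevyMeasure α) ≠ 0 := by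
  intro h0
  rw [lintegral_eq_zero_iff (by fun_prop)] at h0
  have hsub : {r : ℝ | 1 < |r|} \ {r | 2 < |r|} ⊆
      {r | ¬ (ENNReal.ofReal (1 - Real.cos r) = (0 : ℝ → ℝ≥0∞) r)} := by
    rintro r ⟨h1, h2⟩
    simp only [Set.mem_ofPred_eq, not_lt] at h1 h2
    simp only [Set.mem_ofPred_eq, Pi.zero_apply, ENNReal.ofReal_eq_zero, not_le, sub_pos]
    rw [← Real.cos_abs r, ← Real.cos_zero]
    exact Real.cos_lt_cos_of_nonneg_of_le_pi le_rfl (by linarith [Real.pi_gt_three]) (by linarith)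
  have h1 := measure_mono_null hsub h0
  have h12 : {r : ℝ | 2 < |r|} ⊆ {r | 1 < |r|} := by
    intro r (hr : 2 < |r|)
    exact (by linarith : (1 : ℝ) < |r|)
  rw [measure_sdiff h12
    (measurableSet_lt measurable_const (by fun_prop)).nullMeasurableSet
    (by rw [rawLevyMeasure_tail hα two_pos]; exact ENNReal.ofReal_ne_top),
    rawLevyMeasure_tail hα one_pos, rawLevyMeasure_tail hα two_pos, tsub_eq_zero_iff_le,
    ENNReal.ofReal_le_ofReal_iff (by positivity)] at h1
  have := Real.rpow_lt_one_of_one_lt_of_neg (x := 2) (z := -α) (by norm_num) (by linarith)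
  simp only [Real.one_rpow] at h1
  linarith

/-- Dividing the raw measure by `I = ∫ (1 - cos r)` normalises the cosine integral at `s = 1`;
scaling then gives `|s| ^ α` for every `s ≠ 0`. This forces `k = 2 / I` and `K = J / I`, with `J`
the second moment on `|r| ≤ 1`. -/
theorem exists_isStableLevyMeasure {α : ℝ} (hα : 0 < α) (hα₂ : α < 2) :
    ∃ (k K : ℝ) (ν : Measure ℝ), 0 < k ∧ 0 ≤ K ∧ SFinite ν ∧ IsStableLevyMeasure α k K ν := by
  set I := ∫⁻ r, ENNReal.ofReal (1 - Real.cos r) ∂(rawLevyMeasure α) with hI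
  have hI0 := rawLevyMeasure_cosine_ne_zero hα
  have hIt := rawLevyMeasure_cosine_ne_top hα hα₂
  rw [← hI] at hI0 hIt
  have hc : 0 < I⁻¹.toReal := ENNReal.toReal_pos (by simp [hIt]) (by simp [hI0])
  have hI' : I⁻¹ = ENNReal.ofReal I⁻¹.toReal := (ENNReal.ofReal_toReal (by simp [hI0])).symm
  set J := ∫⁻ r in {r | |r| ≤ 1}, ENNReal.ofReal (r ^ 2) ∂(rawLevyMeasure α) with hJ
  have hJt : J ≠ ∞ := (rawLevyMeasure_truncated_lt_top hα hα₂).ne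
  refine ⟨2 * I⁻¹.toReal, I⁻¹.toReal * J.toReal, I⁻¹ • rawLevyMeasure α, by positivity,
    by positivity, inferInstance, ?_, ?_, ?_, ?_⟩
  · intro x hx
    rw [Measure.smul_apply, rawLevyMeasure_tail hα hx, hI', smul_eq_mul,
      ← ENNReal.ofReal_mul (by positivity), ENNReal.toReal_ofReal hc.le]
    congr 1; ring
  · intro y hy
    have hm : ∀ y : ℝ, MeasurableSet {r : ℝ | |r| ≤ y} :=
      fun y => measurableSet_le (by fun_prop) measurable_const
    have key := lintegral_rawLevyMeasure_scale hα (inv_pos.2 hy)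
      ((by fun_prop : Measurable fun r : ℝ => ENNReal.ofReal (r ^ 2)).indicator (hm 1))
    rw [lintegral_indicator (hm 1), ← hJ] at key
    have h2 : ∀ r : ℝ, Set.indicator {r : ℝ | |r| ≤ y} (fun r => ENNReal.ofReal (r ^ 2)) r =
        ENNReal.ofReal (y ^ 2) *
          Set.indicator {r : ℝ | |r| ≤ 1} (fun r => ENNReal.ofReal (r ^ 2)) (y⁻¹ * r) := by
      intro r
      by_cases h : |r| ≤ y
      · have h' : |y⁻¹ * r| ≤ 1 := by
          rw [abs_mul, abs_of_pos (inv_pos.2 hy), inv_mul_le_iff₀ hy]; linarith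
        rw [Set.indicator_of_mem (show r ∈ {r : ℝ | |r| ≤ y} from h),
          Set.indicator_of_mem (show y⁻¹ * r ∈ {r : ℝ | |r| ≤ 1} from h'),
          ← ENNReal.ofReal_mul (by positivity)]
        congr 1; field_simp
      · have h' : ¬ |y⁻¹ * r| ≤ 1 := by
          rw [abs_mul, abs_of_pos (inv_pos.2 hy), inv_mul_le_iff₀ hy]; simpa using h
        rw [Set.indicator_of_notMem (show r ∉ {r : ℝ | |r| ≤ y} from h),
          Set.indicator_of_notMem (show y⁻¹ * r ∉ {r : ℝ | |r| ≤ 1} from h'), mul_zero]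
    rw [Measure.restrict_smul, lintegral_smul_measure, ← lintegral_indicator (hm y)]
    simp_rw [h2]
    rw [lintegral_const_mul' _ _ ENNReal.ofReal_ne_top, key, smul_eq_mul, hI',
      ← ENNReal.ofReal_toReal hJt, ← ENNReal.ofReal_mul (by positivity),
      ← ENNReal.ofReal_mul (by positivity), ← ENNReal.ofReal_mul (by positivity),
      ENNReal.toReal_ofReal (by positivity), ENNReal.toReal_ofReal (by positivity)]
    refine ENNReal.ofReal_le_ofReal (le_of_eq ?_)
    rw [Real.rpow_sub hy, Real.inv_rpow hy.le, Real.rpow_two]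
    field_simp
  · rw [Measure.map_smul, rawLevyMeasure_map_neg]
  · intro s
    rw [lintegral_smul_measure, smul_eq_mul]
    by_cases hs : s = 0
    · subst hs; simp [Real.zero_rpow hα.ne']
    have h := lintegral_rawLevyMeasure_scale hα (abs_pos.2 hs)
      (by fun_prop : Measurable fun r : ℝ => ENNReal.ofReal (1 - Real.cos r))
    have h2 : ∀ r, Real.cos (s * r) = Real.cos (|s| * r) := by
      intro r
      rcases abs_choice s with h | h <;> simp [h]
    simp_rw [h2]
    rw [h, ← hI, mul_left_comm, ENNReal.inv_mul_cancel hI0 hIt, mul_one]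

/-! ### Truncated jumps and their limiting integrals -/

section JumpLaw

variable {Λ : Type*} [MeasurableSpace Λ]

/-- The law of one summand of a triangular array in the domain of attraction of a stable law:
the product of `μ` and the Lévy measure `ν`, restricted to a set of mass `N` and normalised. -/
noncomputable def jumpLaw (α k : ℝ) (μ : Measure Λ) (ν : Measure ℝ) (N : ℕ) : Measure (Λ × ℝ) :=
  (N : ℝ≥0∞)⁻¹ • (μ.prod ν).restrict {p | (k / N) ^ (1 / α) < |p.2|}

theorem measurableSet_lt_abs_snd (x : ℝ) : MeasurableSet {p : Λ × ℝ | x < |p.2|} :=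
  measurableSet_lt measurable_const (by fun_prop)

variable {α k K : ℝ} {ν : Measure ℝ} {μ : Measure Λ}

/-- The cut-off `(k / N) ^ (1 / α)` is the level at which the tail of `ν` equals exactly `N`. -/
theorem isProbabilityMeasure_jumpLaw [SFinite ν] [IsProbabilityMeasure μ] (hα : 0 < α) (hk : 0 < k)
    (hν : IsStableLevyMeasure α k K ν) {N : ℕ} (hN : N ≠ 0) :
    IsProbabilityMeasure (jumpLaw α k μ ν N) := by
  constructor
  have hN' : (0 : ℝ) < N := by exact_mod_cast Nat.pos_of_ne_zero hN
  have hs : {p : Λ × ℝ | (k / N) ^ (1 / α) < |p.2|} =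
      Set.univ ×ˢ {r : ℝ | (k / N) ^ (1 / α) < |r|} := by
    ext p; simp
  rw [jumpLaw, Measure.smul_apply, Measure.restrict_apply_univ, hs, Measure.prod_prod,
    measure_univ, one_mul, hν.tail _ (by positivity), ← Real.rpow_mul (by positivity),
    show 1 / α * -α = -1 by field_simp, Real.rpow_neg_one, inv_div, mul_div_cancel₀ _ hk.ne',
    ENNReal.ofReal_natCast, smul_eq_mul, ENNReal.inv_mul_cancel (by exact_mod_cast hN)
      (ENNReal.natCast_ne_top N)]

theorem jumpLaw_le (N : ℕ) (s : Set (Λ × ℝ)) :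
    jumpLaw α k μ ν N s ≤ (N : ℝ≥0∞)⁻¹ * μ.prod ν s := by
  rw [jumpLaw, Measure.smul_apply, smul_eq_mul]
  gcongr
  exact Measure.restrict_le_self

theorem lintegral_jumpLaw_le (N : ℕ) (G : Λ × ℝ → ℝ≥0∞) :
    ∫⁻ p, G p ∂(jumpLaw α k μ ν N) ≤ (N : ℝ≥0∞)⁻¹ * ∫⁻ p, G p ∂(μ.prod ν) := by
  rw [jumpLaw, lintegral_smul_measure, smul_eq_mul]
  gcongr
  exact Measure.restrict_le_self

theorem jumpLaw_map_neg [SFinite ν] [SFinite μ] (hν : IsStableLevyMeasure α k K ν) (N : ℕ) :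
    (jumpLaw α k μ ν N).map (Prod.map id Neg.neg) = jumpLaw α k μ ν N := by
  have hmeas : Measurable (Prod.map id Neg.neg : Λ × ℝ → Λ × ℝ) := by fun_prop
  have h1 : (μ.prod ν).map (Prod.map id Neg.neg) = μ.prod ν := by
    rw [← Measure.map_prod_map _ _ measurable_id measurable_neg, Measure.map_id, hν.map_neg]
  have h2 := Measure.restrict_map (μ := μ.prod ν) hmeas
    (measurableSet_lt_abs_snd (Λ := Λ) ((k / N) ^ (1 / α)))
  have hpre : Prod.map id Neg.neg ⁻¹' {p : Λ × ℝ | (k / N) ^ (1 / α) < |p.2|} =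
      {p : Λ × ℝ | (k / N) ^ (1 / α) < |p.2|} := by
    ext p; simp
  rw [h1, hpre] at h2
  rw [jumpLaw, Measure.map_smul, ← h2]

/-- The symmetry `r ↦ -r` shows that the integral equals its own negative. It removes the sine part
of characteristic functions and centres the truncated jumps. -/
theorem integral_jumpLaw_eq_zero_of_odd [SFinite ν] [SFinite μ]
    (hν : IsStableLevyMeasure α k K ν) (N : ℕ)
    {G : Λ × ℝ → ℝ} (hG : Measurable G) (hodd : ∀ u r, G (u, -r) = -G (u, r)) :
    ∫ p, G p ∂(jumpLaw α k μ ν N) = 0 := by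
  have h : ∫ p, G p ∂(jumpLaw α k μ ν N) = -∫ p, G p ∂(jumpLaw α k μ ν N) := by
    nth_rewrite 1 [← jumpLaw_map_neg hν N]
    rw [integral_map (by fun_prop) hG.aestronglyMeasurable, ← integral_neg]
    exact integral_congr_ae (ae_of_all _ fun p => hodd p.1 p.2)
  linarith

/-- The factor `N` cancels the normalisation, and the cut-off sets increase to `{r ≠ 0}`; this is
monotone convergence, `G` being zero on the missing slice `r = 0`. -/
theorem tendsto_lintegral_jumpLaw (hα : 0 < α) (hk : 0 < k) {G : Λ × ℝ → ℝ≥0∞}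
    (hG : Measurable G) (hG0 : ∀ u, G (u, 0) = 0) :
    Tendsto (fun N : ℕ => N * ∫⁻ p, G p ∂(jumpLaw α k μ ν N)) atTop
      (𝓝 (∫⁻ p, G p ∂(μ.prod ν))) := by
  rw [← tendsto_add_atTop_iff_nat 1]
  have h1 : ∀ N : ℕ, ((N + 1 : ℕ) : ℝ≥0∞) * ∫⁻ p, G p ∂(jumpLaw α k μ ν (N + 1)) =
      ∫⁻ p, {p : Λ × ℝ | (k / (N + 1 : ℕ)) ^ (1 / α) < |p.2|}.indicator G p ∂(μ.prod ν) := by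
    intro N
    rw [jumpLaw, lintegral_smul_measure, smul_eq_mul, ← mul_assoc,
      ENNReal.mul_inv_cancel (by exact_mod_cast Nat.succ_ne_zero N) (ENNReal.natCast_ne_top _),
      one_mul, lintegral_indicator (measurableSet_lt_abs_snd _)]
  simp_rw [h1]
  refine lintegral_tendsto_of_tendsto_of_monotone
    (fun N => (hG.indicator (measurableSet_lt_abs_snd _)).aemeasurable)
    (ae_of_all _ fun p => ?_) (ae_of_all _ fun p => ?_)
  · intro N M hNM
    refine Set.indicator_le_indicator_of_subset ?_ (fun _ => zero_le) p
    intro q (hq : (k / (N + 1 : ℕ)) ^ (1 / α) < |q.2|)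
    refine lt_of_le_of_lt ?_ hq
    have : (N : ℝ) ≤ M := by exact_mod_cast hNM
    push_cast
    gcongr
  · obtain ⟨u, r⟩ := p
    by_cases hr : r = 0
    · subst hr
      refine tendsto_const_nhds.congr fun N => ?_
      by_cases h : (u, (0 : ℝ)) ∈ {p : Λ × ℝ | (k / (N + 1 : ℕ)) ^ (1 / α) < |p.2|}
      · rw [Set.indicator_of_mem h]
      · rw [Set.indicator_of_notMem h, hG0]
    · have hlim : Tendsto (fun N : ℕ => (k / (N + 1 : ℕ)) ^ (1 / α)) atTop (𝓝 0) := by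
        have h0 : Tendsto (fun N : ℕ => k / ((N + 1 : ℕ) : ℝ)) atTop (𝓝 0) :=
          (tendsto_add_atTop_iff_nat 1).2 (tendsto_const_div_atTop_nhds_zero_nat k)
        have := h0.rpow_const (p := 1 / α) (Or.inr (by positivity))
        rwa [Real.zero_rpow (by positivity)] at this
      refine tendsto_const_nhds.congr' ?_
      filter_upwards [hlim.eventually_lt_const (abs_pos.2 hr)] with N hN
      rw [Set.indicator_of_mem]
      exact hN

/-- For fixed `u` the condition reads `|r| > τ / |h u|`, and homogeneity of the tail turns this into
a factor `|h u| ^ α`. The next two lemmas use the same fibrewise argument. -/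
theorem prod_stable_tail [SFinite ν] [SFinite μ]
    (hα : 0 < α) (hν : IsStableLevyMeasure α k K ν) (hk : 0 < k)
    {h : Λ → ℝ} (hh : Measurable h) {τ : ℝ} (hτ : 0 < τ) :
    μ.prod ν {p | τ < |p.2 * h p.1|} =
      ENNReal.ofReal (k * τ ^ (-α)) * ∫⁻ u, ENNReal.ofReal (|h u| ^ α) ∂μ := by
  have hm : MeasurableSet {p : Λ × ℝ | τ < |p.2 * h p.1|} :=
    measurableSet_lt measurable_const (by fun_prop)
  rw [Measure.prod_apply hm, ← lintegral_const_mul _ (by fun_prop)]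
  refine lintegral_congr fun u => ?_
  by_cases hu : h u = 0
  · simp [Set.preimage, hu, hτ.le.not_gt, Real.zero_rpow hα.ne']
  · have hu' : 0 < |h u| := abs_pos.2 hu
    have : Prod.mk u ⁻¹' {p : Λ × ℝ | τ < |p.2 * h p.1|} = {r | τ / |h u| < |r|} := by
      ext r
      simp only [Set.mem_preimage, Set.mem_ofPred_eq, abs_mul]
      rw [div_lt_iff₀ hu']
    rw [this, hν.tail _ (by positivity), ← ENNReal.ofReal_mul (by positivity),
      Real.div_rpow hτ.le hu'.le, Real.rpow_neg hu'.le, div_inv_eq_mul, mul_assoc]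

theorem prod_stable_truncated [SFinite ν] [SFinite μ] (hν : IsStableLevyMeasure α k K ν)
    (hK : 0 ≤ K) {h : Λ → ℝ} (hh : Measurable h) {τ : ℝ} (hτ : 0 < τ) :
    ∫⁻ p in {p | |p.2 * h p.1| ≤ τ}, ENNReal.ofReal ((p.2 * h p.1) ^ 2) ∂(μ.prod ν) ≤
      ENNReal.ofReal (K * τ ^ (2 - α)) * ∫⁻ u, ENNReal.ofReal (|h u| ^ α) ∂μ := by
  have hm : MeasurableSet {p : Λ × ℝ | |p.2 * h p.1| ≤ τ} :=
    measurableSet_le (by fun_prop) measurable_const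
  rw [← lintegral_indicator hm, lintegral_prod _
    (((by fun_prop : Measurable fun p : Λ × ℝ =>
      ENNReal.ofReal ((p.2 * h p.1) ^ 2)).indicator hm).aemeasurable),
    ← lintegral_const_mul _ (by fun_prop)]
  refine lintegral_mono fun u => ?_
  by_cases hu : h u = 0
  · simp [Set.indicator, hu]
  · have hu' : 0 < |h u| := abs_pos.2 hu
    have hm' : MeasurableSet {r : ℝ | |r| ≤ τ / |h u|} :=
      measurableSet_le (by fun_prop) measurable_const
    have h1 : ∀ r : ℝ, {p : Λ × ℝ | |p.2 * h p.1| ≤ τ}.indicator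
        (fun p => ENNReal.ofReal ((p.2 * h p.1) ^ 2)) (u, r) =
        ENNReal.ofReal (h u ^ 2) *
          {r : ℝ | |r| ≤ τ / |h u|}.indicator (fun r => ENNReal.ofReal (r ^ 2)) r := by
      intro r
      have hiff : |r * h u| ≤ τ ↔ |r| ≤ τ / |h u| := by rw [abs_mul, le_div_iff₀ hu']
      by_cases hr : |r * h u| ≤ τ
      · rw [Set.indicator_of_mem (show (u, r) ∈ {p : Λ × ℝ | |p.2 * h p.1| ≤ τ} from hr),
          Set.indicator_of_mem (show r ∈ {r : ℝ | |r| ≤ τ / |h u|} from hiff.1 hr),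
          ← ENNReal.ofReal_mul (by positivity)]
        congr 1; ring
      · rw [Set.indicator_of_notMem (show (u, r) ∉ {p : Λ × ℝ | |p.2 * h p.1| ≤ τ} from hr),
          Set.indicator_of_notMem
            (show r ∉ {r : ℝ | |r| ≤ τ / |h u|} from fun h => hr (hiff.2 h)), mul_zero]
    simp_rw [h1]
    rw [lintegral_const_mul' _ _ ENNReal.ofReal_ne_top, lintegral_indicator hm']
    refine (mul_le_mul_right (hν.truncated _ (by positivity)) _).trans (le_of_eq ?_)
    rw [← ENNReal.ofReal_mul (by positivity), ← ENNReal.ofReal_mul (by positivity),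
      Real.div_rpow hτ.le hu'.le, Real.rpow_sub hu', Real.rpow_two, sq_abs]
    congr 1
    field_simp

theorem prod_stable_cosine [SFinite ν] [SFinite μ] (hν : IsStableLevyMeasure α k K ν)
    {h : Λ → ℝ} (hh : Measurable h) :
    ∫⁻ p, ENNReal.ofReal (1 - Real.cos (p.2 * h p.1)) ∂(μ.prod ν) =
      ∫⁻ u, ENNReal.ofReal (|h u| ^ α) ∂μ := by
  rw [lintegral_prod _ (by fun_prop)]
  refine lintegral_congr fun u => ?_
  rw [← hν.cosine]
  simp_rw [mul_comm]

/-- Written as `1 + z` with `N z` convergent, the shape needed for the limit of `(1 + z) ^ N`. -/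
theorem integral_cexp_jumpLaw [SFinite ν] [IsProbabilityMeasure μ] (hα : 0 < α) (hk : 0 < k)
    (hν : IsStableLevyMeasure α k K ν) {N : ℕ} (hN : N ≠ 0) {h : Λ → ℝ} (hh : Measurable h) :
    ∫ p, Complex.exp ((p.2 * h p.1 : ℝ) * Complex.I) ∂(jumpLaw α k μ ν N) =
      1 + ((-(∫⁻ p, ENNReal.ofReal (1 - Real.cos (p.2 * h p.1)) ∂(jumpLaw α k μ ν N)).toReal : ℝ)
        : ℂ) := by
  have := isProbabilityMeasure_jumpLaw (μ := μ) hα hk hν hN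
  set m := jumpLaw α k μ ν N
  have hbound : ∀ g : Λ × ℝ → ℝ, Measurable g → (∀ p, |g p| ≤ 1) → Integrable g m :=
    fun g hg hb => Integrable.of_bound hg.aestronglyMeasurable 1 (ae_of_all _ hb)
  have hcos := hbound (fun p => Real.cos (p.2 * h p.1)) (by fun_prop)
    (fun p => Real.abs_cos_le_one _)
  have hsin := hbound (fun p => Real.sin (p.2 * h p.1)) (by fun_prop)
    (fun p => Real.abs_sin_le_one _)
  have hsin0 : ∫ p, Real.sin (p.2 * h p.1) ∂m = 0 :=
    integral_jumpLaw_eq_zero_of_odd hν N (by fun_prop) (fun u r => by simp)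
  have hreal : ∫ p, Real.cos (p.2 * h p.1) ∂m =
      1 - (∫⁻ p, ENNReal.ofReal (1 - Real.cos (p.2 * h p.1)) ∂m).toReal := by
    rw [← integral_eq_lintegral_of_nonneg_ae
      (ae_of_all _ fun p => by simpa using Real.cos_le_one _) (by fun_prop),
      integral_sub (integrable_const _) hcos]
    simp
  have : ∀ p : Λ × ℝ, Complex.exp ((p.2 * h p.1 : ℝ) * Complex.I) =
      ((Real.cos (p.2 * h p.1) : ℝ) : ℂ) + ((Real.sin (p.2 * h p.1) : ℝ) : ℂ) * Complex.I := by
    intro p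
    rw [Complex.exp_mul_I, Complex.ofReal_cos, Complex.ofReal_sin]
  simp_rw [this]
  rw [integral_add hcos.ofReal (hsin.ofReal.mul_const _), integral_mul_const,
    integral_complex_ofReal, integral_complex_ofReal, hsin0, hreal]
  push_cast
  ring

end JumpLaw

/-! ### Sums of independent variables -/

section Sums

variable {N : ℕ} {y : Fin N → ℝ} {τ a : ℝ}

/-- One-big-jump decomposition: the truncated sum omits nothing, or precisely the unique term above
`τ`. The next two lemmas deduce the two directions of the comparison between the sum and the largest
term. -/
theorem sum_eq_or_sum_eq_add_of_single_large (hsingle : ∀ j l, j ≠ l → τ < |y j| → ¬ τ < |y l|) :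
    ((∀ j, |y j| ≤ τ) ∧ ∑ j, y j = ∑ j, if |y j| ≤ τ then y j else 0) ∨
      ∃ j₀, τ < |y j₀| ∧ (∀ j, j ≠ j₀ → |y j| ≤ τ) ∧
        ∑ j, y j = y j₀ + ∑ j, if |y j| ≤ τ then y j else 0 := by
  by_cases h : ∃ j₀, τ < |y j₀|
  · obtain ⟨j₀, hj₀⟩ := h
    refine Or.inr ⟨j₀, hj₀, fun j hj => not_lt.1 (hsingle j₀ j hj.symm hj₀), ?_⟩
    rw [← sub_eq_iff_eq_add, ← Finset.sum_sub_distrib, Finset.sum_eq_single j₀]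
    · simp [hj₀.not_ge]
    · intro j _ hj
      simp [not_lt.1 (hsingle j₀ j hj.symm hj₀)]
    · simp
  · push Not at h
    exact Or.inl ⟨h, by simp [h]⟩

theorem abs_le_of_abs_sum_lt (hsingle : ∀ j l, j ≠ l → τ < |y j| → ¬ τ < |y l|)
    (hsmall : |∑ j, if |y j| ≤ τ then y j else 0| < 4 * τ) (ha : |∑ j, y j| < a) (j : Fin N) :
    |y j| ≤ a + 4 * τ := by
  have hτ : 0 < τ := by linarith [(abs_nonneg _).trans_lt hsmall]
  have ha0 : 0 < a := (abs_nonneg _).trans_lt ha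
  rcases sum_eq_or_sum_eq_add_of_single_large hsingle with ⟨h, -⟩ | ⟨j₀, -, h, hsum⟩
  · linarith [h j]
  · by_cases hj : j = j₀
    · subst hj
      rw [eq_sub_of_add_eq hsum.symm]
      exact (abs_sub _ _).trans (by linarith)
    · linarith [h j hj]

theorem abs_sum_le_of_abs_le (hsingle : ∀ j l, j ≠ l → τ < |y j| → ¬ τ < |y l|)
    (hsmall : |∑ j, if |y j| ≤ τ then y j else 0| < 4 * τ) (ha₀ : 0 ≤ a)
    (ha : ∀ j, |y j| ≤ a) : |∑ j, y j| ≤ a + 4 * τ := by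
  rcases sum_eq_or_sum_eq_add_of_single_large hsingle with ⟨-, hsum⟩ | ⟨j₀, -, -, hsum⟩
  · rw [hsum]; linarith
  · rw [hsum]
    exact (abs_add_le _ _).trans (by linarith [ha j₀])

/-- Second-order Taylor remainder of the exponential series, used to bound a moment generating
function by the variance. -/
theorem exp_le_one_add_add_sq_mul_exp_abs (y : ℝ) :
    Real.exp y ≤ 1 + y + y ^ 2 * Real.exp |y| := by
  have h := Complex.norm_exp_sub_sum_le_norm_mul_exp (y : ℂ) 2
  have h2 : Complex.exp (y : ℂ) - ∑ m ∈ Finset.range 2, (y : ℂ) ^ m / (m.factorial : ℂ) =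
      ((Real.exp y - (1 + y) : ℝ) : ℂ) := by
    simp [Finset.sum_range_succ]
  rw [h2, Complex.norm_real, Complex.norm_real, Real.norm_eq_abs, Real.norm_eq_abs, sq_abs] at h
  linarith [le_abs_self (Real.exp y - (1 + y))]

variable {E : Type*} [MeasurableSpace E]

/-- Union bound over at most `N²` ordered pairs, each of probability at most `(q / N)²` by
independence. The square matters: the probability of one hit would be too large to sum over `B_n`.
-/
theorem measure_pi_two_hits_le (m : Measure E) [IsProbabilityMeasure m] {S : Set E}
    {q : ℝ≥0∞} (hq : m S ≤ (N : ℝ≥0∞)⁻¹ * q) :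
    Measure.pi (fun _ : Fin N => m) {x | ∃ j l, j ≠ l ∧ x j ∈ S ∧ x l ∈ S} ≤ q ^ 2 := by
  rcases Nat.eq_zero_or_pos N with hN | hN
  · subst hN; simp
  have hsub : {x : Fin N → E | ∃ j l, j ≠ l ∧ x j ∈ S ∧ x l ∈ S} ⊆
      ⋃ p : Fin N × Fin N, {x | p.1 ≠ p.2 ∧ x p.1 ∈ S ∧ x p.2 ∈ S} := by
    rintro x ⟨j, l, h⟩
    exact Set.mem_iUnion.2 ⟨(j, l), h⟩
  refine (measure_mono hsub).trans ((measure_iUnion_fintype_le _ _).trans ?_)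
  have hp : ∀ p : Fin N × Fin N,
      Measure.pi (fun _ : Fin N => m) {x | p.1 ≠ p.2 ∧ x p.1 ∈ S ∧ x p.2 ∈ S} ≤
        ((N : ℝ≥0∞)⁻¹ * q) ^ 2 := by
    rintro ⟨j, l⟩
    by_cases hjl : j = l
    · simp [hjl]
    have : {x : Fin N → E | j ≠ l ∧ x j ∈ S ∧ x l ∈ S} =
        Set.pi (({j, l} : Finset (Fin N)) : Set (Fin N)) (fun _ => S) := by
      ext x; simp [hjl]
    rw [this, Measure.pi_pi_finset, Finset.prod_pair hjl, ← sq]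
    gcongr
  refine (Finset.sum_le_sum fun p _ => hp p).trans (le_of_eq ?_)
  rw [Finset.sum_const, Finset.card_univ, Fintype.card_prod, Fintype.card_fin, nsmul_eq_mul,
    mul_pow, ← mul_assoc, Nat.cast_mul, ← sq, ← mul_pow,
    ENNReal.mul_inv_cancel (by exact_mod_cast hN.ne') (ENNReal.natCast_ne_top N), one_pow, one_mul]

/-- Chernoff bound. A centred variable bounded by `1` with second moment at most `w / N` has
exponential moment at most `exp(θ² e^θ w / N)`; the `N`-th power no longer depends on `N`, so the
bound survives the limit. -/
theorem measure_pi_sum_ge_le (hN : N ≠ 0) (m : Measure E) [IsProbabilityMeasure m] {X : E → ℝ}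
    (hX : Measurable X) (hb : ∀ p, |X p| ≤ 1) (h0 : ∫ p, X p ∂m = 0) {w : ℝ}
    (hw : ∫ p, X p ^ 2 ∂m ≤ w / N) {θ : ℝ} (hθ : 0 ≤ θ) (t : ℝ) :
    Measure.pi (fun _ : Fin N => m) {x | t ≤ ∑ j, X (x j)} ≤
      ENNReal.ofReal (Real.exp (-θ * t + θ ^ 2 * Real.exp θ * w)) := by
  have hint : ∀ g : E → ℝ, Measurable g → ∀ C : ℝ, (∀ p, |g p| ≤ C) → Integrable g m :=
    fun g hg C hC => Integrable.of_bound hg.aestronglyMeasurable C (ae_of_all _ hC)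
  have hmgf : ∫ p, Real.exp (θ * X p) ∂m ≤ Real.exp (θ ^ 2 * Real.exp θ * (w / N)) := by
    have hIX := hint X hX 1 hb
    have hIX2 := hint (fun p => X p ^ 2) (by fun_prop) 1 fun p => by
      rw [abs_pow]; exact pow_le_one₀ (abs_nonneg _) (hb p)
    have hle : ∀ p, Real.exp (θ * X p) ≤ 1 + θ * X p + θ ^ 2 * Real.exp θ * X p ^ 2 := by
      intro p
      refine (exp_le_one_add_add_sq_mul_exp_abs _).trans ?_
      have h1 : |θ * X p| ≤ θ := by
        rw [abs_mul, abs_of_nonneg hθ]; exact mul_le_of_le_one_right hθ (hb p)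
      have h2 := Real.exp_le_exp.2 h1
      have h3 : (θ * X p) ^ 2 * Real.exp |θ * X p| ≤ (θ * X p) ^ 2 * Real.exp θ := by gcongr
      nlinarith
    calc ∫ p, Real.exp (θ * X p) ∂m
        ≤ ∫ p, (1 + θ * X p + θ ^ 2 * Real.exp θ * X p ^ 2) ∂m :=
          integral_mono (hint _ (by fun_prop) (Real.exp θ) fun p => by
              rw [abs_of_pos (Real.exp_pos _), Real.exp_le_exp]
              exact mul_le_of_le_one_right hθ ((le_abs_self _).trans (hb p)))
            (((integrable_const _).add (hIX.const_mul _)).add (hIX2.const_mul _)) hle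
      _ = 1 + θ ^ 2 * Real.exp θ * ∫ p, X p ^ 2 ∂m := by
          have hI1 : Integrable (fun p => 1 + θ * X p) m :=
            (integrable_const _).add (hIX.const_mul _)
          rw [integral_add hI1 (hIX2.const_mul _),
            integral_add (integrable_const _) (hIX.const_mul _), integral_const_mul,
            integral_const_mul, h0]
          simp
      _ ≤ 1 + θ ^ 2 * Real.exp θ * (w / N) := by gcongr
      _ ≤ _ := by linarith [Real.add_one_le_exp (θ ^ 2 * Real.exp θ * (w / N))]
  have hsum : ∫ x, Real.exp (θ * ∑ j, X (x j)) ∂(Measure.pi fun _ : Fin N => m) =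
      (∫ p, Real.exp (θ * X p) ∂m) ^ N := by
    have := integral_fintype_prod_eq_pow (ι := Fin N) (𝕜 := ℝ) (μ := m)
      (fun p => Real.exp (θ * X p))
    rw [Fintype.card_fin] at this
    rw [← this]
    congr 1 with x
    rw [Finset.mul_sum, Real.exp_sum]
  have hmarkov := ProbabilityTheory.measure_ge_le_exp_mul_mgf
    (μ := Measure.pi fun _ : Fin N => m) (X := fun x => ∑ j, X (x j)) t hθ
    (Integrable.of_bound (Measurable.aestronglyMeasurable (by fun_prop)) (Real.exp (θ * N))
      (ae_of_all _ fun x => by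
      rw [Real.norm_of_nonneg (Real.exp_pos _).le, Real.exp_le_exp]
      gcongr
      refine (Finset.sum_le_sum fun j _ => (le_abs_self _).trans (hb (x j))).trans ?_
      simp))
  rw [ProbabilityTheory.mgf, hsum] at hmarkov
  rw [← ofReal_measureReal]
  refine ENNReal.ofReal_le_ofReal (hmarkov.trans ?_)
  have hN' : (N : ℝ) ≠ 0 := by exact_mod_cast hN
  rw [Real.exp_add]
  gcongr
  refine (pow_le_pow_left₀ (integral_nonneg fun p => (Real.exp_pos _).le) hmgf N).trans
    (le_of_eq ?_)
  rw [← Real.exp_nat_mul]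
  congr 1
  field_simp

end Sums

/-! ### Comparison of sums with single jumps -/

section Array

variable {Λ : Type*} [MeasurableSpace Λ] {α k K : ℝ} {ν : Measure ℝ} [SFinite ν]
  {μ : Measure Λ} [IsProbabilityMeasure μ] {N : ℕ}

theorem jumpLaw_large_le (hα : 0 < α) (hk : 0 < k) (hν : IsStableLevyMeasure α k K ν)
    {h : Λ → ℝ} (hh : Measurable h) (hh1 : ∫⁻ u, ENNReal.ofReal (|h u| ^ α) ∂μ ≤ 1)
    {τ : ℝ} (hτ : 0 < τ) :
    jumpLaw α k μ ν N {p | τ < |p.2 * h p.1|} ≤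
      (N : ℝ≥0∞)⁻¹ * ENNReal.ofReal (k * τ ^ (-α)) := by
  refine (jumpLaw_le N _).trans ?_
  rw [prod_stable_tail hα hν hk hh hτ]
  gcongr
  exact mul_le_of_le_one_right zero_le hh1

/-- The truncated jumps, divided by `τ`, are centred by symmetry and have second moment at most `K
τ^{-α} / N`, so the Chernoff bound applies at level `4`. -/
theorem measure_pi_truncated_sum_ge_le (hN : N ≠ 0) (hα : 0 < α) (hk : 0 < k) (hK : 0 ≤ K)
    (hν : IsStableLevyMeasure α k K ν) {h : Λ → ℝ} (hh : Measurable h)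
    (hh1 : ∫⁻ u, ENNReal.ofReal (|h u| ^ α) ∂μ ≤ 1) {τ θ : ℝ} (hτ : 0 < τ) (hθ : 0 ≤ θ) :
    Measure.pi (fun _ : Fin N => jumpLaw α k μ ν N)
      {x | 4 * τ ≤ ∑ j, if |(x j).2 * h (x j).1| ≤ τ then (x j).2 * h (x j).1 else 0} ≤
      ENNReal.ofReal (Real.exp (-θ * 4 + θ ^ 2 * Real.exp θ * (K * τ ^ (-α)))) := by
  have := isProbabilityMeasure_jumpLaw (μ := μ) hα hk hν hN
  set T : Λ × ℝ → ℝ := fun p => if |p.2 * h p.1| ≤ τ then p.2 * h p.1 else 0 with hT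
  have hset : MeasurableSet {p : Λ × ℝ | |p.2 * h p.1| ≤ τ} :=
    measurableSet_le (by fun_prop) measurable_const
  have hTm : Measurable T := Measurable.ite hset (by fun_prop) measurable_const
  have hTb : ∀ p, |T p| ≤ τ := by
    intro p
    simp only [hT]
    split_ifs with hp
    · exact hp
    · simpa using hτ.le
  have hN' : (0 : ℝ) < N := by exact_mod_cast Nat.pos_of_ne_zero hN
  have hsq : ∫ p, (τ⁻¹ * T p) ^ 2 ∂(jumpLaw α k μ ν N) ≤ K * τ ^ (-α) / N := by
    rw [integral_eq_lintegral_of_nonneg_ae (ae_of_all _ fun p => sq_nonneg _)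
      (Measurable.aestronglyMeasurable (by fun_prop))]
    refine ENNReal.toReal_le_of_le_ofReal (by positivity) ?_
    have h1 : ∀ p, ENNReal.ofReal ((τ⁻¹ * T p) ^ 2) = ENNReal.ofReal ((τ⁻¹) ^ 2) *
        {p : Λ × ℝ | |p.2 * h p.1| ≤ τ}.indicator
          (fun p => ENNReal.ofReal ((p.2 * h p.1) ^ 2)) p := by
      intro p
      rw [mul_pow, ENNReal.ofReal_mul (by positivity)]
      congr 1
      by_cases hp : |p.2 * h p.1| ≤ τ
      · rw [Set.indicator_of_mem (show p ∈ {p : Λ × ℝ | |p.2 * h p.1| ≤ τ} from hp)]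
        simp only [hT, if_pos hp]
      · rw [Set.indicator_of_notMem (show p ∉ {p : Λ × ℝ | |p.2 * h p.1| ≤ τ} from hp)]
        simp only [hT, if_neg hp]
        simp
    refine (lintegral_jumpLaw_le N _).trans ?_
    simp_rw [h1]
    rw [lintegral_const_mul' _ _ ENNReal.ofReal_ne_top, lintegral_indicator hset]
    calc (N : ℝ≥0∞)⁻¹ * (ENNReal.ofReal (τ⁻¹ ^ 2) * _)
        ≤ (N : ℝ≥0∞)⁻¹ * (ENNReal.ofReal (τ⁻¹ ^ 2) * ENNReal.ofReal (K * τ ^ (2 - α))) := by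
          gcongr
          exact (prod_stable_truncated hν hK hh hτ).trans (mul_le_of_le_one_right zero_le hh1)
      _ = ENNReal.ofReal (K * τ ^ (-α) / N) := by
          rw [← ENNReal.ofReal_natCast, ← ENNReal.ofReal_inv_of_pos hN',
            ← ENNReal.ofReal_mul (by positivity), ← ENNReal.ofReal_mul (by positivity)]
          congr 1
          rw [Real.rpow_sub hτ, Real.rpow_neg hτ.le, Real.rpow_two]
          field_simp
  have hmean : ∫ p, τ⁻¹ * T p ∂(jumpLaw α k μ ν N) = 0 := by
    refine integral_jumpLaw_eq_zero_of_odd hν N (by fun_prop) fun u r => ?_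
    simp only [hT, neg_mul, abs_neg]
    split_ifs <;> ring
  have key := measure_pi_sum_ge_le hN (jumpLaw α k μ ν N) (X := fun p => τ⁻¹ * T p)
    (by fun_prop) (fun p => by
      rw [abs_mul, abs_of_pos (inv_pos.2 hτ), inv_mul_le_iff₀ hτ, mul_one]; exact hTb p)
    hmean hsq hθ 4
  refine le_trans (le_of_eq ?_) key
  congr 1
  ext x
  simp only [Set.mem_ofPred_eq]
  rw [← Finset.mul_sum, le_inv_mul_iff₀ hτ, mul_comm τ 4]

variable {ι : Type*}

/-- The configurations of `N` jumps for which, in some coordinate, two jumps exceed `τ`, or the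
jumps bounded by `τ` add up to at least `4 * τ`. -/
def irregularJumps (f : ι → Λ → ℝ) (τ : ℝ) (N : ℕ) : Set (Fin N → Λ × ℝ) :=
  {x | ∃ i, (∃ j l, j ≠ l ∧ τ < |(x j).2 * f i (x j).1| ∧ τ < |(x l).2 * f i (x l).1|) ∨
    4 * τ ≤ |∑ j, if |(x j).2 * f i (x j).1| ≤ τ then (x j).2 * f i (x j).1 else 0|}

theorem measure_irregularJumps_le [Fintype ι] (hN : N ≠ 0) (hα : 0 < α) (hk : 0 < k) (hK : 0 ≤ K)
    (hν : IsStableLevyMeasure α k K ν) {f : ι → Λ → ℝ} (hf : ∀ i, Measurable (f i))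
    (hf1 : ∀ i, ∫⁻ u, ENNReal.ofReal (|f i u| ^ α) ∂μ ≤ 1)
    {τ θ : ℝ} (hτ : 0 < τ) (hθ : 0 ≤ θ) :
    Measure.pi (fun _ : Fin N => jumpLaw α k μ ν N) (irregularJumps f τ N) ≤
      ENNReal.ofReal (Fintype.card ι * ((k * τ ^ (-α)) ^ 2 +
        2 * Real.exp (-θ * 4 + θ ^ 2 * Real.exp θ * (K * τ ^ (-α))))) := by
  have := isProbabilityMeasure_jumpLaw (μ := μ) hα hk hν hN
  set R := Real.exp (-θ * 4 + θ ^ 2 * Real.exp θ * (K * τ ^ (-α))) with hR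
  set Q := Measure.pi (fun _ : Fin N => jumpLaw α k μ ν N)
  have hi : ∀ i, Q {x | (∃ j l, j ≠ l ∧ τ < |(x j).2 * f i (x j).1| ∧ τ < |(x l).2 * f i (x l).1|) ∨
      4 * τ ≤ |∑ j, if |(x j).2 * f i (x j).1| ≤ τ then (x j).2 * f i (x j).1 else 0|} ≤
      ENNReal.ofReal ((k * τ ^ (-α)) ^ 2 + 2 * R) := by
    intro i
    have h1 := measure_pi_two_hits_le (N := N) (jumpLaw α k μ ν N)
      (jumpLaw_large_le (N := N) hα hk hν (hf i) (hf1 i) hτ)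
    have h2 := measure_pi_truncated_sum_ge_le hN hα hk hK hν (hf i) (hf1 i) hτ hθ
    -- The lower tail of the truncated sum is the upper tail for `-f i`.
    have h3 := measure_pi_truncated_sum_ge_le (h := fun u => -f i u) hN hα hk hK hν (hf i).neg
      (by simpa using hf1 i) hτ hθ
    rw [ENNReal.ofReal_add (by positivity) (by positivity), two_mul,
      ENNReal.ofReal_add (by positivity) (by positivity), ENNReal.ofReal_pow (by positivity)]
    refine le_trans ?_ (add_le_add h1 (add_le_add h2 h3))
    refine le_trans (measure_mono ?_) ((measure_union_le _ _).trans
      (add_le_add le_rfl (measure_union_le _ _)))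
    rintro x (hx | hx)
    · exact Or.inl hx
    · rcases le_abs'.1 hx with hx | hx
      · refine Or.inr (Or.inr ?_)
        simp only [Set.mem_ofPred_eq, mul_neg, abs_neg]
        have : ∀ j, (if |(x j).2 * f i (x j).1| ≤ τ then -((x j).2 * f i (x j).1) else 0) =
            -(if |(x j).2 * f i (x j).1| ≤ τ then (x j).2 * f i (x j).1 else 0) := by
          intro j; split_ifs <;> simp
        simp_rw [this, Finset.sum_neg_distrib]
        linarith
      · exact Or.inr (Or.inl hx)
  have hunion : irregularJumps f τ N = ⋃ i, {x | (∃ j l, j ≠ l ∧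
      τ < |(x j).2 * f i (x j).1| ∧ τ < |(x l).2 * f i (x l).1|) ∨
      4 * τ ≤ |∑ j, if |(x j).2 * f i (x j).1| ≤ τ then (x j).2 * f i (x j).1 else 0|} := by
    ext x; simp [irregularJumps]
  rw [hunion]
  refine (measure_iUnion_fintype_le _ _).trans ((Finset.sum_le_sum fun i _ => hi i).trans ?_)
  rw [Finset.sum_const, Finset.card_univ, nsmul_eq_mul, ENNReal.ofReal_mul (by positivity),
    ENNReal.ofReal_natCast]

/-- Off the irregular set, small sums force every jump to be small; independence turns the latter
event into an `N`-th power. -/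
theorem measure_sums_lt_le (hN : N ≠ 0) (hα : 0 < α) (hk : 0 < k)
    (hν : IsStableLevyMeasure α k K ν) (f : ι → Λ → ℝ) (τ a : ℝ) :
    Measure.pi (fun _ : Fin N => jumpLaw α k μ ν N) {x | ∀ i, |∑ j, (x j).2 * f i (x j).1| < a} ≤
      jumpLaw α k μ ν N {p | ∀ i, |p.2 * f i p.1| ≤ a + 4 * τ} ^ N +
        Measure.pi (fun _ : Fin N => jumpLaw α k μ ν N) (irregularJumps f τ N) := by
  have := isProbabilityMeasure_jumpLaw (μ := μ) hα hk hν hN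
  have hpow : jumpLaw α k μ ν N {p | ∀ i, |p.2 * f i p.1| ≤ a + 4 * τ} ^ N =
      Measure.pi (fun _ : Fin N => jumpLaw α k μ ν N)
        (Set.pi Set.univ fun _ => {p | ∀ i, |p.2 * f i p.1| ≤ a + 4 * τ}) := by
    rw [Measure.pi_pi]; simp
  rw [hpow]
  refine le_trans (measure_mono fun x hx => ?_) (measure_union_le _ _)
  by_cases hirr : x ∈ irregularJumps f τ N
  · exact Or.inr hirr
  · refine Or.inl fun j _ i => ?_
    simp only [irregularJumps, Set.mem_ofPred_eq, not_exists, not_or, not_and, not_le] at hirr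
    exact abs_le_of_abs_sum_lt (y := fun j => (x j).2 * f i (x j).1)
      (fun j l hjl => (hirr i).1 j l hjl) (hirr i).2 (hx i) j

theorem le_measure_sums_le (hN : N ≠ 0) (hα : 0 < α) (hk : 0 < k)
    (hν : IsStableLevyMeasure α k K ν) (f : ι → Λ → ℝ) (τ : ℝ) {a : ℝ} (ha : 0 ≤ a) :
    jumpLaw α k μ ν N {p | ∀ i, |p.2 * f i p.1| ≤ a} ^ N ≤
      Measure.pi (fun _ : Fin N => jumpLaw α k μ ν N)
        {x | ∀ i, |∑ j, (x j).2 * f i (x j).1| ≤ a + 4 * τ} +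
        Measure.pi (fun _ : Fin N => jumpLaw α k μ ν N) (irregularJumps f τ N) := by
  have := isProbabilityMeasure_jumpLaw (μ := μ) hα hk hν hN
  have hpow : jumpLaw α k μ ν N {p | ∀ i, |p.2 * f i p.1| ≤ a} ^ N =
      Measure.pi (fun _ : Fin N => jumpLaw α k μ ν N)
        (Set.pi Set.univ fun _ => {p | ∀ i, |p.2 * f i p.1| ≤ a}) := by
    rw [Measure.pi_pi]; simp
  rw [hpow]
  refine le_trans (measure_mono fun x hx => ?_) (measure_union_le _ _)
  by_cases hirr : x ∈ irregularJumps f τ N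
  · exact Or.inr hirr
  · refine Or.inl fun i => ?_
    simp only [irregularJumps, Set.mem_ofPred_eq, not_exists, not_or, not_and, not_le] at hirr
    exact abs_sum_le_of_abs_le (y := fun j => (x j).2 * f i (x j).1)
      (fun j l hjl => (hirr i).1 j l hjl) (hirr i).2 ha (fun j => hx j (Set.mem_univ j) i)

end Array

/-! ### Passage to the stable limit -/

section Limit

variable {Λ : Type*} [MeasurableSpace Λ] {ι : Type*}

/-- The vector of sums of `N` jumps. -/
noncomputable def jumpSum (f : ι → Λ → ℝ) (N : ℕ) (x : Fin N → Λ × ℝ) : EuclideanSpace ℝ ι :=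
  WithLp.toLp 2 fun i => ∑ j, (x j).2 * f i (x j).1

theorem measurable_jumpSum {f : ι → Λ → ℝ} (hf : ∀ i, Measurable (f i)) (N : ℕ) :
    Measurable (jumpSum f N) := by
  unfold jumpSum
  fun_prop

variable [Fintype ι] {α k K : ℝ} {μ : Measure Λ}

theorem abs_mul_iSup_le_iff [Nonempty ι] (y : ι → ℝ) (r a : ℝ) :
    |r * (⨆ i, |y i|)| ≤ a ↔ ∀ i, |r * y i| ≤ a := by
  have hb : BddAbove (Set.range fun i => |y i|) := Set.finite_range _ |>.bddAbove
  have h0 : 0 ≤ ⨆ i, |y i| := Real.iSup_nonneg fun i => abs_nonneg _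
  simp_rw [abs_mul, abs_of_nonneg h0]
  constructor
  · intro h i
    exact le_trans (by gcongr; exact le_ciSup hb i) h
  · intro h
    obtain ⟨i, hi⟩ := exists_eq_ciSup_of_finite (f := fun i => |y i|)
    rw [← hi]; exact h i

theorem lintegral_iSup_rpow_ne_top [Nonempty ι] {f : ι → Λ → ℝ}
    (hf : ∀ i, Measurable (f i)) (hf1 : ∀ i, ∫⁻ u, ENNReal.ofReal (|f i u| ^ α) ∂μ ≤ 1) :
    ∫⁻ u, ENNReal.ofReal (|(⨆ i, |f i u|)| ^ α) ∂μ ≠ ∞ := by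
  refine ne_top_of_le_ne_top (b := ∑ i : ι, ∫⁻ u, ENNReal.ofReal (|f i u| ^ α) ∂μ) ?_ ?_
  · exact (ENNReal.sum_lt_top.2 fun i _ => (hf1 i).trans_lt ENNReal.one_lt_top).ne
  · rw [← lintegral_finsetSum _ (fun i _ => by fun_prop)]
    refine lintegral_mono fun u => ?_
    obtain ⟨i, hi⟩ := exists_eq_ciSup_of_finite (f := fun i => |f i u|)
    rw [← hi, abs_abs]
    exact Finset.single_le_sum (f := fun i => ENNReal.ofReal (|f i u| ^ α))
      (fun _ _ => zero_le) (Finset.mem_univ i)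

variable {ν : Measure ℝ} [SFinite ν] [IsProbabilityMeasure μ]

/-- All coordinates of a jump are at most `a` exactly when `|r| max |f i u| ≤ a`. The complementary
probability `p_N` satisfies `N p_N → (μ ⊗ ν){|r| max |f i u| > a}`, so `(1 - p_N) ^ N` has an
exponential limit. -/
theorem tendsto_jumpLaw_pow (hα : 0 < α) (hk : 0 < k) (hν : IsStableLevyMeasure α k K ν)
    [Nonempty ι] {f : ι → Λ → ℝ} (hf : ∀ i, Measurable (f i))
    (hf1 : ∀ i, ∫⁻ u, ENNReal.ofReal (|f i u| ^ α) ∂μ ≤ 1) {a : ℝ} (ha : 0 < a) :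
    Tendsto (fun N : ℕ => (jumpLaw α k μ ν N {p | ∀ i, |p.2 * f i p.1| ≤ a}).toReal ^ N) atTop
      (𝓝 (Real.exp (-(k * a ^ (-α) *
        (∫⁻ u, ENNReal.ofReal (|(⨆ i, |f i u|)| ^ α) ∂μ).toReal)))) := by
  set h : Λ → ℝ := fun u => ⨆ i, |f i u|
  have hh : Measurable h := Measurable.iSup fun i => by fun_prop
  have hset : {p : Λ × ℝ | ∀ i, |p.2 * f i p.1| ≤ a} = {p | a < |p.2 * h p.1|}ᶜ := by
    ext p
    simp only [Set.mem_ofPred_eq, Set.mem_compl_iff, not_lt]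
    exact (abs_mul_iSup_le_iff (fun i => f i p.1) p.2 a).symm
  have hS : MeasurableSet {p : Λ × ℝ | a < |p.2 * h p.1|} :=
    measurableSet_lt measurable_const (by fun_prop)
  have hfin : μ.prod ν {p : Λ × ℝ | a < |p.2 * h p.1|} ≠ ∞ := by
    rw [prod_stable_tail hα hν hk hh ha]
    exact ENNReal.mul_ne_top ENNReal.ofReal_ne_top (lintegral_iSup_rpow_ne_top hf hf1)
  have h1 := tendsto_lintegral_jumpLaw (μ := μ) (ν := ν) hα hk
    (measurable_one.indicator hS : Measurable
      ({p : Λ × ℝ | a < |p.2 * h p.1|}.indicator (1 : Λ × ℝ → ℝ≥0∞)))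
    (fun u => by simp [ha.le])
  simp_rw [lintegral_indicator_one hS] at h1
  have h2 := (ENNReal.tendsto_toReal hfin).comp h1
  have h3 : Tendsto (fun N : ℕ => (N : ℝ) *
      -(jumpLaw α k μ ν N {p | a < |p.2 * h p.1|}).toReal) atTop
      (𝓝 (-(k * a ^ (-α) * (∫⁻ u, ENNReal.ofReal (|h u| ^ α) ∂μ).toReal))) := by
    rw [prod_stable_tail hα hν hk hh ha, ENNReal.toReal_mul,
      ENNReal.toReal_ofReal (by positivity)] at h2
    refine h2.neg.congr fun N => ?_
    simp
  refine (Real.tendsto_one_add_pow_exp_of_tendsto h3).congr' ?_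
  filter_upwards [eventually_ne_atTop 0] with N hN
  have := isProbabilityMeasure_jumpLaw (μ := μ) hα hk hν hN
  rw [hset]
  congr 1
  have := probReal_compl_eq_one_sub (μ := jumpLaw α k μ ν N) hS
  simp only [measureReal_def] at this
  rw [this]
  ring

variable {Ω : Type*} [MeasurableSpace Ω] {P : Measure Ω}

/-- Pairing with `t` reduces the vector to the scalar kernel `h = ∑ t i * f i`; by independence the
characteristic function is the `N`-th power of that of one jump. -/
theorem tendsto_charFun_jumpSum (hα : 0 < α) (hk : 0 < k) (hν : IsStableLevyMeasure α k K ν)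
    {f : ι → Λ → ℝ} (hf : ∀ i, Measurable (f i)) (t : EuclideanSpace ℝ ι)
    (hint : Integrable (fun u => |∑ i, t i * f i u| ^ α) μ) :
    Tendsto (fun N : ℕ => charFun
      ((Measure.pi fun _ : Fin N => jumpLaw α k μ ν N).map (jumpSum f N)) t) atTop
      (𝓝 ((Real.exp (-∫ u, |∑ i, t i * f i u| ^ α ∂μ) : ℝ) : ℂ)) := by
  set h : Λ → ℝ := fun u => ∑ i, t i * f i u
  have hh : Measurable h := by fun_prop
  have heq : ∫⁻ u, ENNReal.ofReal (|h u| ^ α) ∂μ = ENNReal.ofReal (∫ u, |h u| ^ α ∂μ) :=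
    (ofReal_integral_eq_lintegral_ofReal hint (ae_of_all _ fun u => by positivity)).symm
  have h1 := tendsto_lintegral_jumpLaw (μ := μ) (ν := ν) hα hk
    (by fun_prop : Measurable fun p : Λ × ℝ => ENNReal.ofReal (1 - Real.cos (p.2 * h p.1)))
    (fun u => by simp)
  rw [prod_stable_cosine hν hh, heq] at h1
  have h2 := (ENNReal.tendsto_toReal ENNReal.ofReal_ne_top).comp h1
  rw [ENNReal.toReal_ofReal (integral_nonneg fun u => by positivity)] at h2
  have h3 : Tendsto (fun N : ℕ => (N : ℂ) * ((-(∫⁻ p, ENNReal.ofReal (1 - Real.cos (p.2 * h p.1))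
      ∂(jumpLaw α k μ ν N)).toReal : ℝ) : ℂ)) atTop (𝓝 ((-∫ u, |h u| ^ α ∂μ : ℝ) : ℂ)) := by
    refine ((Complex.continuous_ofReal.tendsto _).comp h2.neg).congr fun N => ?_
    simp
  have h4 := Complex.tendsto_one_add_pow_exp_of_tendsto h3
  rw [← Complex.ofReal_exp] at h4
  refine h4.congr' ?_
  filter_upwards [eventually_ne_atTop 0] with N hN
  have := isProbabilityMeasure_jumpLaw (μ := μ) hα hk hν hN
  rw [← integral_cexp_jumpLaw hα hk hν hN hh, charFun_apply,
    integral_map (measurable_jumpSum hf N).aemeasurable (by fun_prop)]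
  have h5 := integral_fintype_prod_eq_pow (ι := Fin N) (𝕜 := ℂ) (μ := jumpLaw α k μ ν N)
    (fun p => Complex.exp ((p.2 * h p.1 : ℝ) * Complex.I))
  rw [Fintype.card_fin] at h5
  rw [← h5]
  congr 1 with x
  rw [← Complex.exp_sum, ← Finset.sum_mul, ← Complex.ofReal_sum]
  congr 3
  simp only [jumpSum, PiLp.inner_apply, RCLike.inner_apply, conj_trivial, h, Finset.mul_sum]
  rw [Finset.sum_comm]
  refine Finset.sum_congr rfl fun i _ => Finset.sum_congr rfl fun j _ => ?_
  ring

theorem tendsto_law_jumpSum (hα : 0 < α) (hk : 0 < k) (hν : IsStableLevyMeasure α k K ν)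
    {f : ι → Λ → ℝ} (hf : ∀ i, Measurable (f i))
    (hint : ∀ t : ι → ℝ, Integrable (fun u => |∑ i, t i * f i u| ^ α) μ)
    {Y : ι → Ω → ℝ} (hY : ∀ i, AEMeasurable (Y i) P)
    (hchar : ∀ t : ι → ℝ, charFun (P.map fun ω => ∑ i, t i * Y i ω) 1 =
      ((Real.exp (-∫ u, |∑ i, t i * f i u| ^ α ∂μ) : ℝ) : ℂ))
    (Q : ℕ → ProbabilityMeasure (EuclideanSpace ℝ ι))
    (hQ : ∀ N, (Q N : Measure (EuclideanSpace ℝ ι)) =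
      (Measure.pi fun _ : Fin (N + 1) => jumpLaw α k μ ν (N + 1)).map (jumpSum f (N + 1)))
    (R : ProbabilityMeasure (EuclideanSpace ℝ ι))
    (hR : (R : Measure (EuclideanSpace ℝ ι)) =
      P.map fun ω => WithLp.toLp 2 fun i => Y i ω) :
    Tendsto Q atTop (𝓝 R) := by
  refine ProbabilityMeasure.tendsto_of_tendsto_charFun fun t => ?_
  have hlim := (tendsto_add_atTop_iff_nat 1).2
    (tendsto_charFun_jumpSum hα hk hν hf t (hint t))
  have hYm : AEMeasurable (fun ω => WithLp.toLp 2 fun i => Y i ω : Ω → EuclideanSpace ℝ ι) P :=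
    (by fun_prop : Measurable fun y : ι → ℝ =>
      (WithLp.toLp 2 y : EuclideanSpace ℝ ι)).comp_aemeasurable (aemeasurable_pi_lambda _ hY)
  have hchar' : charFun (R : Measure (EuclideanSpace ℝ ι)) t =
      ((Real.exp (-∫ u, |∑ i, t i * f i u| ^ α ∂μ) : ℝ) : ℂ) := by
    rw [← hchar t, hR, charFun_apply, charFun_apply, integral_map hYm (by fun_prop),
      integral_map (Finset.aemeasurable_fun_sum _ fun i _ => (hY i).const_mul _) (by fun_prop)]
    congr 1 with ω
    congr 3
    simp [PiLp.inner_apply]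
  rw [hchar']
  exact hlim.congr fun N => by rw [hQ N]

end Limit

/-! ### Distribution of the maximum of a stable vector -/

section MaxBounds

variable {Λ : Type*} [MeasurableSpace Λ] {α k K : ℝ} {ν : Measure ℝ} [SFinite ν]
  {μ : Measure Λ} [IsProbabilityMeasure μ] {ι : Type*} [Fintype ι] [Nonempty ι]
  {Ω : Type*} [MeasurableSpace Ω] {P : Measure Ω} [IsProbabilityMeasure P]

/-- Two-sided bounds for the distribution function of the maximum modulus of a symmetric stable
vector `Y` with spectral functions `f`, in terms of `∫ max |f i| ^ α`. -/
theorem stable_max_bounds (hα : 0 < α) (hk : 0 < k) (hK : 0 ≤ K)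
    (hν : IsStableLevyMeasure α k K ν)
    {f : ι → Λ → ℝ} (hf : ∀ i, Measurable (f i))
    (hf1 : ∀ i, ∫⁻ u, ENNReal.ofReal (|f i u| ^ α) ∂μ ≤ 1)
    (hint : ∀ t : ι → ℝ, Integrable (fun u => |∑ i, t i * f i u| ^ α) μ)
    {Y : ι → Ω → ℝ} (hY : ∀ i, AEMeasurable (Y i) P)
    (hchar : ∀ t : ι → ℝ, charFun (P.map fun ω => ∑ i, t i * Y i ω) 1 =
      ((Real.exp (-∫ u, |∑ i, t i * f i u| ^ α ∂μ) : ℝ) : ℂ))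
    {τ θ a : ℝ} (hτ : 0 < τ) (hθ : 0 ≤ θ) (ha : 0 < a) :
    P.real {ω | ∀ i, |Y i ω| < a} ≤
      Real.exp (-(k * (a + 4 * τ) ^ (-α) *
        (∫⁻ u, ENNReal.ofReal (|(⨆ i, |f i u|)| ^ α) ∂μ).toReal)) +
      Fintype.card ι * ((k * τ ^ (-α)) ^ 2 +
        2 * Real.exp (-θ * 4 + θ ^ 2 * Real.exp θ * (K * τ ^ (-α)))) ∧
    Real.exp (-(k * a ^ (-α) *
        (∫⁻ u, ENNReal.ofReal (|(⨆ i, |f i u|)| ^ α) ∂μ).toReal)) ≤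
      P.real {ω | ∀ i, |Y i ω| ≤ a + 4 * τ} +
      Fintype.card ι * ((k * τ ^ (-α)) ^ 2 +
        2 * Real.exp (-θ * 4 + θ ^ 2 * Real.exp θ * (K * τ ^ (-α)))) := by
  set I := (∫⁻ u, ENNReal.ofReal (|(⨆ i, |f i u|)| ^ α) ∂μ).toReal
  set bad := Fintype.card ι * ((k * τ ^ (-α)) ^ 2 +
        2 * Real.exp (-θ * 4 + θ ^ 2 * Real.exp θ * (K * τ ^ (-α)))) with hbad
  have hbad0 : 0 ≤ bad := by positivity
  have hprob : ∀ N : ℕ, IsProbabilityMeasure (jumpLaw α k μ ν (N + 1)) :=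
    fun N => isProbabilityMeasure_jumpLaw hα hk hν N.succ_ne_zero
  have hYm : AEMeasurable (fun ω => WithLp.toLp 2 fun i => Y i ω : Ω → EuclideanSpace ℝ ι) P :=
    (by fun_prop : Measurable fun y : ι → ℝ =>
      (WithLp.toLp 2 y : EuclideanSpace ℝ ι)).comp_aemeasurable (aemeasurable_pi_lambda _ hY)
  let Q : ℕ → ProbabilityMeasure (EuclideanSpace ℝ ι) := fun N =>
    ⟨(Measure.pi fun _ : Fin (N + 1) => jumpLaw α k μ ν (N + 1)).map (jumpSum f (N + 1)),
      Measure.isProbabilityMeasure_map (measurable_jumpSum hf _).aemeasurable⟩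
  let R : ProbabilityMeasure (EuclideanSpace ℝ ι) :=
    ⟨P.map fun ω => WithLp.toLp 2 fun i => Y i ω, Measure.isProbabilityMeasure_map hYm⟩
  have hQR : Tendsto Q atTop (𝓝 R) :=
    tendsto_law_jumpSum hα hk hν hf hint hY hchar Q (fun _ => rfl) R rfl
  have hirr : ∀ N : ℕ, Measure.pi (fun _ : Fin (N + 1) => jumpLaw α k μ ν (N + 1))
      (irregularJumps f τ (N + 1)) ≤ ENNReal.ofReal bad :=
    fun N => measure_irregularJumps_le N.succ_ne_zero hα hk hK hν hf hf1 hτ hθ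
  have hpow : ∀ b : ℝ, 0 < b → Tendsto (fun N : ℕ => (jumpLaw α k μ ν (N + 1)
      {p | ∀ i, |p.2 * f i p.1| ≤ b}).toReal ^ (N + 1)) atTop
      (𝓝 (Real.exp (-(k * b ^ (-α) * I)))) :=
    fun b hb => (tendsto_add_atTop_iff_nat 1).2 (tendsto_jumpLaw_pow hα hk hν hf hf1 hb)
  have hofReal : ∀ (N : ℕ) (b : ℝ), jumpLaw α k μ ν (N + 1)
      {p | ∀ i, |p.2 * f i p.1| ≤ b} ^ (N + 1) = ENNReal.ofReal ((jumpLaw α k μ ν (N + 1)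
      {p | ∀ i, |p.2 * f i p.1| ≤ b}).toReal ^ (N + 1)) := by
    intro N b
    rw [ENNReal.ofReal_pow ENNReal.toReal_nonneg, ENNReal.ofReal_toReal (measure_ne_top _ _)]
  constructor
  -- Weak convergence bounds the limit measure of an open set from above by a liminf, hence the
  -- strict inequality here; the lower bound uses a closed set.
  · have hopen : IsOpen {y : EuclideanSpace ℝ ι | ∀ i, |y i| < a} := by
      simp only [Set.ofPred_forall]
      exact isOpen_iInter_of_finite fun i => isOpen_lt (by fun_prop) continuous_const
    have h1 := ProbabilityMeasure.le_liminf_measure_open_of_tendsto hQR hopen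
    have hR : (R : Measure (EuclideanSpace ℝ ι)) {y | ∀ i, |y i| < a} =
        P {ω | ∀ i, |Y i ω| < a} := Measure.map_apply_of_aemeasurable hYm hopen.measurableSet
    have hQ : ∀ N, (Q N : Measure (EuclideanSpace ℝ ι)) {y | ∀ i, |y i| < a} ≤
        ENNReal.ofReal ((jumpLaw α k μ ν (N + 1)
          {p | ∀ i, |p.2 * f i p.1| ≤ a + 4 * τ}).toReal ^ (N + 1) + bad) := by
      intro N
      rw [ENNReal.ofReal_add (by positivity) hbad0, ← hofReal]
      refine le_trans (le_of_eq (Measure.map_apply (measurable_jumpSum hf _)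
        hopen.measurableSet)) ?_
      exact (measure_sums_lt_le N.succ_ne_zero hα hk hν f τ a).trans (by gcongr; exact hirr N)
    have hlim := (ENNReal.continuous_ofReal.tendsto _).comp
      ((hpow (a + 4 * τ) (by positivity)).add_const bad)
    have h2 := h1.trans ((liminf_le_liminf (Eventually.of_forall hQ)).trans hlim.liminf_eq.le)
    rw [hR] at h2
    exact ENNReal.toReal_le_of_le_ofReal (by positivity) h2
  · have hclosed : IsClosed {y : EuclideanSpace ℝ ι | ∀ i, |y i| ≤ a + 4 * τ} := by
      simp only [Set.ofPred_forall]
      exact isClosed_iInter fun i => isClosed_le (by fun_prop) continuous_const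
    have h1 := ProbabilityMeasure.limsup_measure_closed_le_of_tendsto hQR hclosed
    have hR : (R : Measure (EuclideanSpace ℝ ι)) {y | ∀ i, |y i| ≤ a + 4 * τ} =
        P {ω | ∀ i, |Y i ω| ≤ a + 4 * τ} :=
      Measure.map_apply_of_aemeasurable hYm hclosed.measurableSet
    have hQ : ∀ N, ENNReal.ofReal ((jumpLaw α k μ ν (N + 1)
          {p | ∀ i, |p.2 * f i p.1| ≤ a}).toReal ^ (N + 1) - bad) ≤
        (Q N : Measure (EuclideanSpace ℝ ι)) {y | ∀ i, |y i| ≤ a + 4 * τ} := by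
      intro N
      rw [ENNReal.ofReal_sub _ hbad0, ← hofReal, tsub_le_iff_right]
      refine ((le_measure_sums_le N.succ_ne_zero hα hk hν f τ ha.le).trans
        (add_le_add (le_of_eq ?_) (hirr N)))
      exact (Measure.map_apply (measurable_jumpSum hf _) hclosed.measurableSet).symm
    have hlim := (ENNReal.continuous_ofReal.tendsto _).comp ((hpow a ha).sub_const bad)
    have h2 := hlim.limsup_eq.ge.trans ((limsup_le_limsup (Eventually.of_forall hQ)).trans h1)
    rw [hR, ENNReal.ofReal_le_iff_le_toReal (measure_ne_top _ _)] at h2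
    rw [measureReal_def]
    linarith

end MaxBounds

/-! ### Distribution functions and Fréchet limits -/

section Frechet

variable {Ω Ω' : Type*} [MeasurableSpace Ω] [MeasurableSpace Ω']
  {P : Measure Ω} [IsProbabilityMeasure P] {P' : Measure Ω'}

theorem map_real_Ioc {X : Ω → ℝ} (hX : AEMeasurable X P) {a b : ℝ} (hab : a ≤ b) :
    (P.map X).real (Set.Ioc a b) = P.real {ω | X ω ≤ b} - P.real {ω | X ω ≤ a} := by
  have := Measure.isProbabilityMeasure_map hX
  have h : ∀ c, (P.map X).real (Set.Iic c) = P.real {ω | X ω ≤ c} := fun c => by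
    rw [measureReal_def, Measure.map_apply_of_aemeasurable hX measurableSet_Iic]; rfl
  rw [← h, ← h, ← measureReal_sdiff (Set.Iic_subset_Iic.2 hab) measurableSet_Iic,
    Set.Iic_sdiff_Iic]

theorem tendstoInDistribution_of_tendsto_cdf [IsProbabilityMeasure P'] {X : ℕ → Ω → ℝ} {W : Ω' → ℝ}
    (hX : ∀ n, AEMeasurable (X n) P) (hW : AEMeasurable W P')
    (h : ∀ x, Tendsto (fun n => P.real {ω | X n ω ≤ x}) atTop (𝓝 (P'.real {ω | W ω ≤ x}))) :
    TendstoInDistribution X atTop W (fun _ => P) P' where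
  forall_aemeasurable := hX
  aemeasurable_limit := hW
  tendsto := by
    refine IsPiSystem.tendsto_probabilityMeasure_of_tendsto_of_mem
      (isPiSystem_Ioc (id : ℝ → ℝ) id) ?_ ?_ ?_
    · rintro s ⟨a, b, -, rfl⟩
      exact measurableSet_Ioc
    · intro u hu x hx
      obtain ⟨ε, hε, hsub⟩ := Metric.isOpen_iff.1 hu x hx
      refine ⟨Set.Ioc (x - ε / 2) (x + ε / 2), ⟨x - ε / 2, x + ε / 2, by simp; linarith, rfl⟩,
        Ioc_mem_nhds (by linarith) (by linarith), fun y hy => hsub ?_⟩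
      rw [Metric.mem_ball, Real.dist_eq, abs_lt]
      constructor <;> linarith [hy.1, hy.2]
    · rintro s ⟨a, b, hab, rfl⟩
      simp only [id] at hab ⊢
      rw [← NNReal.tendsto_coe]
      have key := (h b).sub (h a)
      rw [← map_real_Ioc hW hab.le] at key
      exact key.congr fun n => (map_real_Ioc (hX n) hab.le).symm

variable {α k : ℝ}

/-- For fixed `ε` the error `b n * M ε` vanishes as `n → ∞`; only afterwards does `ε → 0`, so no
control of `M` near `0` is needed. -/
theorem tendsto_cdf_of_bounds {X : ℕ → Ω → ℝ} {C b : ℕ → ℝ} {L : ℝ} {M : ℝ → ℝ}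
    (hb : Tendsto b atTop (𝓝 0)) (hC : Tendsto C atTop (𝓝 L))
    (hupper : ∀ n, ∀ x > 0, ∀ ε > 0,
      P.real {ω | X n ω < x} ≤ Real.exp (-(k * (x + 4 * ε) ^ (-α) * C n)) + b n * M ε)
    (hlower : ∀ n, ∀ x > 0, ∀ ε > 0,
      Real.exp (-(k * x ^ (-α) * C n)) ≤ P.real {ω | X n ω ≤ x + 4 * ε} + b n * M ε)
    {x : ℝ} (hx : 0 < x) :
    Tendsto (fun n => P.real {ω | X n ω ≤ x}) atTop (𝓝 (Real.exp (-(k * x ^ (-α) * L)))) := by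
  have hlim : ∀ y ε : ℝ, Tendsto (fun n => Real.exp (-(k * y ^ (-α) * C n)) + b n * M ε) atTop
      (𝓝 (Real.exp (-(k * y ^ (-α) * L)))) := by
    intro y ε
    have := ((Real.continuous_exp.tendsto _).comp ((hC.const_mul (k * y ^ (-α))).neg)).add
      (hb.mul_const (M ε))
    simpa using this
  have hlim' : ∀ y ε : ℝ, Tendsto (fun n => Real.exp (-(k * y ^ (-α) * C n)) - b n * M ε) atTop
      (𝓝 (Real.exp (-(k * y ^ (-α) * L)))) := by
    intro y ε
    have := ((Real.continuous_exp.tendsto _).comp ((hC.const_mul (k * y ^ (-α))).neg)).sub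
      (hb.mul_const (M ε))
    simpa using this
  have hcont : ∀ c : ℝ, Tendsto (fun ε : ℝ => Real.exp (-(k * (x + c * ε) ^ (-α) * L))) (𝓝[>] 0)
      (𝓝 (Real.exp (-(k * x ^ (-α) * L)))) := by
    intro c
    have h1 : ContinuousAt (fun ε : ℝ => Real.exp (-(k * (x + c * ε) ^ (-α) * L))) 0 := by
      have h2 : ContinuousAt (fun ε : ℝ => (x + c * ε) ^ (-α)) 0 :=
        ContinuousAt.rpow_const (by fun_prop) (Or.inl (by simpa using hx.ne'))
      exact Real.continuous_exp.continuousAt.comp ((h2.const_mul k).mul_const L).neg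
    have h3 := h1.tendsto
    simp only [mul_zero, add_zero] at h3
    exact h3.mono_left nhdsWithin_le_nhds
  rw [tendsto_order]
  constructor
  · intro u hu
    obtain ⟨ε, hε, hε0, hεx⟩ := (((hcont (-4)).eventually (lt_mem_nhds hu)).and
      (Ioo_mem_nhdsGT (show (0 : ℝ) < x / 4 by positivity))).exists
    filter_upwards [(hlim' (x + -4 * ε) ε).eventually (lt_mem_nhds hε)] with n hn
    have h := hlower n (x + -4 * ε) (by linarith) ε hε0
    rw [show x + -4 * ε + 4 * ε = x by ring] at h
    linarith
  · intro u hu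
    -- The `5` is the shift `4ε` plus one `ε` for passing from `≤ x` to `< x + ε`.
    obtain ⟨ε, hε, hε0⟩ := (((hcont 5).eventually (gt_mem_nhds hu)).and
      self_mem_nhdsWithin).exists
    have hε0 : 0 < ε := hε0
    filter_upwards [(hlim (x + 5 * ε) ε).eventually (gt_mem_nhds hε)] with n hn
    have h := hupper n (x + ε) (by linarith) ε hε0
    rw [show x + ε + 4 * ε = x + 5 * ε by ring] at h
    refine lt_of_le_of_lt ((measureReal_mono fun ω hω => ?_).trans h) hn
    have hω : X n ω ≤ x := hω
    exact (by linarith : X n ω < x + ε)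

theorem IsFrechet.cdf_mul {Z : Ω' → ℝ} (hZ : IsFrechet Z P' α) {κ : ℝ} (hκ : 0 < κ) (x : ℝ) :
    P'.real {ω | κ * Z ω ≤ x} = if 0 < x then Real.exp (-(κ ^ α * x ^ (-α))) else 0 := by
  have h := hZ.2 (x / κ)
  rw [Measure.map_apply_of_aemeasurable hZ.1 measurableSet_Iic] at h
  have hset : {ω | κ * Z ω ≤ x} = Z ⁻¹' Set.Iic (x / κ) := by
    ext ω
    simp only [Set.mem_ofPred_eq, Set.mem_preimage, Set.mem_Iic]
    rw [le_div_iff₀ hκ, mul_comm]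
  rw [measureReal_def, hset, h]
  by_cases hx : 0 < x
  · rw [if_pos hx, if_pos (by positivity), ENNReal.toReal_ofReal (Real.exp_pos _).le,
      Real.div_rpow hx.le hκ.le, Real.rpow_neg hκ.le, div_inv_eq_mul, mul_comm (κ ^ α)]
  · rw [if_neg hx, if_neg, ENNReal.toReal_zero]
    exact fun h => hx ((div_pos_iff_of_pos_right hκ).1 h)

theorem tendstoInDistribution_frechet [IsProbabilityMeasure P'] {X : ℕ → Ω → ℝ}
    (hα : 0 < α) {Z : Ω' → ℝ}
    (hZ : IsFrechet Z P' α) {κ : ℝ} (hκ : 0 < κ) (hX : ∀ n, AEMeasurable (X n) P)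
    (hcdf : ∀ x > 0, Tendsto (fun n => P.real {ω | X n ω ≤ x}) atTop
      (𝓝 (Real.exp (-(κ ^ α * x ^ (-α)))))) :
    TendstoInDistribution X atTop (fun ω => κ * Z ω) (fun _ => P) P' := by
  refine tendstoInDistribution_of_tendsto_cdf hX (hZ.1.const_mul κ) fun x => ?_
  rw [hZ.cdf_mul hκ]
  split_ifs with hx
  · exact hcdf x hx
  · have hκα : 0 < κ ^ α := Real.rpow_pos_of_pos hκ α
    -- For `x ≤ 0` the distribution function at `x` is dominated by its value at a small `y > 0`,
    -- where the limit is arbitrarily small.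
    have hsmall : Tendsto (fun y : ℝ => Real.exp (-(κ ^ α * y ^ (-α)))) (𝓝[>] 0) (𝓝 0) :=
      Real.tendsto_exp_neg_atTop_nhds_zero.comp
        ((tendsto_rpow_neg_nhdsGT_zero (by linarith)).const_mul_atTop hκα)
    rw [tendsto_order]
    refine ⟨fun u hu => Eventually.of_forall fun n => hu.trans_le measureReal_nonneg,
      fun u hu => ?_⟩
    obtain ⟨y, hy, hy0⟩ := ((hsmall.eventually (gt_mem_nhds hu)).and self_mem_nhdsWithin).exists
    have hy0 : 0 < y := hy0
    filter_upwards [(hcdf y hy0).eventually (gt_mem_nhds hy)] with n hn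
    refine lt_of_le_of_lt (measureReal_mono fun ω hω => ?_) hn
    have hω : X n ω ≤ x := hω
    exact (by linarith : X n ω ≤ y)

theorem tendstoInMeasure_zero_of_cdf {X : ℕ → Ω → ℝ} (h0 : ∀ n ω, 0 ≤ X n ω)
    (hX : ∀ n, AEMeasurable (X n) P)
    (hcdf : ∀ x > 0, Tendsto (fun n => P.real {ω | X n ω ≤ x}) atTop (𝓝 1)) :
    TendstoInMeasure P X atTop (fun _ => (0 : ℝ)) := by
  rw [tendstoInMeasure_iff_measureReal_norm]
  intro ε hε
  have h1 := (hcdf (ε / 2) (by positivity)).const_sub 1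
  rw [sub_self] at h1
  refine squeeze_zero (fun _ => measureReal_nonneg) (fun n => ?_) h1
  have hnull : NullMeasurableSet {ω | X n ω ≤ ε / 2} P :=
    (hX n).nullMeasurable (measurableSet_Iic (a := ε / 2))
  rw [← probReal_compl_eq_one_sub₀ hnull]
  refine measureReal_mono fun ω hω => ?_
  have hω : ε ≤ ‖X n ω - 0‖ := hω
  rw [sub_zero, Real.norm_of_nonneg (h0 n ω)] at hω
  simp only [Set.mem_compl_iff, Set.mem_ofPred_eq]
  linarith

end Frechet

/-! ### Maxima of the Rosiński field -/

section Field

variable {G : Type*} [Group G] {Λ : Type*} [MeasurableSpace Λ] [MulAction G Λ]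
  {μ : Measure Λ} {c : G → Λ → ℝ} {α : ℝ}

theorem IsSignCocycle.measurable_rosinskiKernel (hc : IsSignCocycle μ c) (g : G) :
    Measurable (rosinskiKernel α μ c g) :=
  (hc.measurable g).mul ((Measure.measurable_rnDeriv _ _).ennreal_toReal.pow_const _)

theorem IsSignCocycle.abs_rosinskiKernel_rpow (hc : IsSignCocycle μ c) (hα : 0 < α) (g : G)
    (ξ : Λ) : |rosinskiKernel α μ c g ξ| ^ α = ((μ.map (g • ·)).rnDeriv μ ξ).toReal := by
  have hsign : |c g ξ| = 1 := by rcases hc.sign g ξ with h | h <;> simp [h]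
  rw [rosinskiKernel, abs_mul, hsign, one_mul, abs_of_nonneg (by positivity),
    ← Real.rpow_mul ENNReal.toReal_nonneg, one_div_mul_cancel hα.ne', Real.rpow_one]

theorem IsSignCocycle.lintegral_rosinskiKernel_le [IsProbabilityMeasure μ]
    (hc : IsSignCocycle μ c) (hα : 0 < α) (g : G) :
    ∫⁻ ξ, ENNReal.ofReal (|rosinskiKernel α μ c g ξ| ^ α) ∂μ ≤ 1 := by
  simp_rw [hc.abs_rosinskiKernel_rpow hα]
  refine (lintegral_mono fun ξ => ENNReal.ofReal_toReal_le).trans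
    (Measure.lintegral_rnDeriv_le.trans ?_)
  by_cases h : AEMeasurable (fun ξ : Λ => g • ξ) μ
  · rw [Measure.map_apply_of_aemeasurable h MeasurableSet.univ]
    exact prob_le_one
  -- Measurability of the action is not assumed here; without it the push-forward is zero by
  -- convention.
  · rw [Measure.map_of_not_aemeasurable h]
    simp

/-- Each kernel lies in `L^α`, which is closed under finite sums even when `α < 1`. -/
theorem IsSignCocycle.integrable_sum [IsProbabilityMeasure μ]
    (hc : IsSignCocycle μ c) (hα : 0 < α) {ι : Type*} [Fintype ι]
    (e : ι → G) (t : ι → ℝ) :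
    Integrable (fun ξ => |∑ i, t i * rosinskiKernel α μ c (e i) ξ| ^ α) μ := by
  have hp0 : ENNReal.ofReal α ≠ 0 := by simpa using hα
  have hmem : ∀ i, MemLp (fun ξ => t i * rosinskiKernel α μ c (e i) ξ) (ENNReal.ofReal α) μ := by
    intro i
    refine MemLp.const_mul ?_ _
    refine (integrable_norm_rpow_iff (hc.measurable_rosinskiKernel (e i)).aestronglyMeasurable
      hp0 ENNReal.ofReal_ne_top).1 ?_
    rw [ENNReal.toReal_ofReal hα.le]
    refine ⟨((hc.measurable_rosinskiKernel (e i)).norm.pow_const _).aestronglyMeasurable, ?_⟩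
    rw [hasFiniteIntegral_iff_ofReal (ae_of_all _ fun ξ => by positivity)]
    exact (hc.lintegral_rosinskiKernel_le hα (e i)).trans_lt ENNReal.one_lt_top
  have := (memLp_finsetSum Finset.univ fun i _ => hmem i).integrable_norm_rpow hp0
    ENNReal.ofReal_ne_top
  simpa [ENNReal.toReal_ofReal hα.le] using this

variable {X : Type*} [MetricSpace X] [MulAction G X] {o : X} {v : ℝ}

theorem one_mem_orbitBall (n : ℕ) : (1 : G) ∈ orbitBall G o n := by
  simp [orbitBall]

/-- The signs disappear in absolute value and `t ↦ t ^ α` is increasing, so it commutes with the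
finite maximum; the derivatives are finite almost everywhere. -/
theorem IsSignCocycle.lintegral_maxCocycle [IsProbabilityMeasure μ]
    (hc : IsSignCocycle μ c) (hα : 0 < α) {n : ℕ}
    {s : Finset G} (hs : ∀ g, g ∈ s ↔ g ∈ orbitBall G o n) :
    ∫⁻ ξ, maxCocycle G o μ n ξ ∂μ =
      ∫⁻ ξ, ENNReal.ofReal (|(⨆ g : s, |rosinskiKernel α μ c (g : G) ξ|)| ^ α) ∂μ := by
  have hne : Nonempty s := ⟨⟨1, (hs 1).2 (one_mem_orbitBall n)⟩⟩
  have hfin : ∀ᵐ ξ ∂μ, ∀ g : s, (μ.map ((g : G) • ·)).rnDeriv μ ξ < ∞ :=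
    ae_all_iff.2 fun g => Measure.rnDeriv_lt_top _ _
  refine lintegral_congr_ae ?_
  filter_upwards [hfin] with ξ hξ
  have heq : ∀ g : s, ENNReal.ofReal (|rosinskiKernel α μ c (g : G) ξ| ^ α) =
      (μ.map ((g : G) • ·)).rnDeriv μ ξ := fun g => by
    rw [hc.abs_rosinskiKernel_rpow hα, ENNReal.ofReal_toReal (hξ g).ne]
  have hbdd : BddAbove (Set.range fun g : s => |rosinskiKernel α μ c (g : G) ξ|) :=
    (Set.finite_range _).bddAbove
  apply le_antisymm
  · refine iSup₂_le fun g hg => ?_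
    rw [← heq ⟨g, (hs g).2 hg⟩]
    refine ENNReal.ofReal_le_ofReal ?_
    exact Real.rpow_le_rpow (abs_nonneg _)
      ((le_ciSup hbdd ⟨g, (hs g).2 hg⟩).trans (le_abs_self _)) hα.le
  · obtain ⟨g, hg⟩ := exists_eq_ciSup_of_finite
      (f := fun g : s => |rosinskiKernel α μ c (g : G) ξ|)
    rw [← hg, abs_abs, heq]
    exact le_iSup₂ (f := fun (g : G) (_ : g ∈ orbitBall G o n) => (μ.map (g • ·)).rnDeriv μ ξ)
      (g : G) ((hs g).1 g.2)

variable {Ω : Type*} {Y : G → Ω → ℝ}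

theorem scaledMax_le_iff (hfin : ∀ n, (orbitBall G o n).Finite) (n : ℕ) (ω : Ω) (x : ℝ) :
    scaledMax o v α Y n ω ≤ x ↔
      ∀ g ∈ orbitBall G o n, |Y g ω| ≤ x * volGrowth v n ^ (1 / α) := by
  have hV : 0 < volGrowth v n ^ (1 / α) := Real.rpow_pos_of_pos (Real.exp_pos _) _
  have : Finite (orbitBall G o n) := hfin n
  have : Nonempty (orbitBall G o n) := ⟨⟨1, one_mem_orbitBall n⟩⟩
  rw [scaledMax, div_le_iff₀ hV, partialMax, ciSup_le_iff (Set.finite_range _).bddAbove]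
  simp

theorem scaledMax_lt_iff (hfin : ∀ n, (orbitBall G o n).Finite) (n : ℕ) (ω : Ω) (x : ℝ) :
    scaledMax o v α Y n ω < x ↔
      ∀ g ∈ orbitBall G o n, |Y g ω| < x * volGrowth v n ^ (1 / α) := by
  have hV : 0 < volGrowth v n ^ (1 / α) := Real.rpow_pos_of_pos (Real.exp_pos _) _
  have : Finite (orbitBall G o n) := hfin n
  have : Nonempty (orbitBall G o n) := ⟨⟨1, one_mem_orbitBall n⟩⟩
  rw [scaledMax, div_lt_iff₀ hV, partialMax]
  obtain ⟨g₀, hg₀⟩ := exists_eq_ciSup_of_finite (f := fun g : orbitBall G o n => |Y g ω|)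
  constructor
  · intro h g hg
    exact (le_ciSup (f := fun g : orbitBall G o n => |Y g ω|)
      (Set.finite_range _).bddAbove ⟨g, hg⟩).trans_lt h
  · intro h
    rw [← hg₀]
    exact h g₀ g₀.2

theorem scaledMax_nonneg (n : ℕ) (ω : Ω) : 0 ≤ scaledMax o v α Y n ω :=
  div_nonneg (Real.iSup_nonneg fun _ => abs_nonneg _)
    (Real.rpow_nonneg (Real.exp_pos _).le _)

variable [MeasurableSpace Ω] {P : Measure Ω}

theorem HasRosinskiRepresentation.aemeasurable (hY : HasRosinskiRepresentation α μ c P Y) (g : G) :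
    AEMeasurable (Y g) P := by
  simpa using (hY {g} fun _ => 1).1

theorem HasRosinskiRepresentation.charFun_sum (hY : HasRosinskiRepresentation α μ c P Y)
    (hα : 0 < α) (s : Finset G) (t : s → ℝ) :
    charFun (P.map fun ω => ∑ i : s, t i * Y i ω) 1 =
      ((Real.exp (-∫ ξ, |∑ i : s, t i * rosinskiKernel α μ c (i : G) ξ| ^ α ∂μ) : ℝ) : ℂ) := by
  classical
  -- The coefficients on `s` are extended by zero to all of `G`.
  have hsum : ∀ F : G → ℝ, ∑ g ∈ s, (if h : g ∈ s then t ⟨g, h⟩ else 0) * F g =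
      ∑ i : s, t i * F i := by
    intro F
    rw [← Finset.sum_coe_sort]
    exact Finset.sum_congr rfl fun i _ => by simp
  have h := (hY s fun g => if h : g ∈ s then t ⟨g, h⟩ else 0).2 1
  have h1 : (fun ω => ∑ g ∈ s, (if h : g ∈ s then t ⟨g, h⟩ else 0) * Y g ω) =
      fun ω => ∑ i : s, t i * Y i ω := funext fun ω => hsum fun g => Y g ω
  have h2 : ∀ ξ, ∑ g ∈ s, (if h : g ∈ s then t ⟨g, h⟩ else 0) * rosinskiKernel α μ c g ξ =
      ∑ i : s, t i * rosinskiKernel α μ c (i : G) ξ :=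
    fun ξ => hsum fun g => rosinskiKernel α μ c g ξ
  simp_rw [h2] at h
  rw [h1] at h
  rw [h, abs_one, Real.one_rpow, mul_one, ← Real.rpow_mul (integral_nonneg fun ξ => by positivity),
    one_div_mul_cancel hα.ne', Real.rpow_one]

theorem HasRosinskiRepresentation.aemeasurable_scaledMax
    (hY : HasRosinskiRepresentation α μ c P Y) (hfin : ∀ n, (orbitBall G o n).Finite) (n : ℕ) :
    AEMeasurable (scaledMax o v α Y n) P := by
  have : Finite (orbitBall G o n) := hfin n
  exact (AEMeasurable.iSup (ι := orbitBall G o n) (f := fun g ω => |Y g ω|)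
    fun g => measurable_abs.comp_aemeasurable (hY.aemeasurable (g : G))).div_const _

/-- With `V = e^{2θ}`, both contributions are of order `V^{-2} = e^{-4θ}`: the Chernoff correction
stays bounded since `θ² e^θ / V ≤ 2`. The level `4` of the truncated sum was chosen for this match.
-/
theorem stable_error_le {k K ε θ : ℝ} (hK : 0 ≤ K) (hε : 0 < ε) (hα : 0 < α) (hθ : 0 ≤ θ)
    {V : ℝ} (hV : V = Real.exp (2 * θ)) :
    (k * (ε * V ^ (1 / α)) ^ (-α)) ^ 2 +
        2 * Real.exp (-θ * 4 + θ ^ 2 * Real.exp θ * (K * (ε * V ^ (1 / α)) ^ (-α))) ≤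
      Real.exp (-(4 * θ)) * ((k * ε ^ (-α)) ^ 2 + 2 * Real.exp (2 * K * ε ^ (-α))) := by
  have hVpos : 0 < V := hV ▸ Real.exp_pos _
  have h1 : (ε * V ^ (1 / α)) ^ (-α) = ε ^ (-α) * Real.exp (-(2 * θ)) := by
    rw [Real.mul_rpow hε.le (by positivity), ← Real.rpow_mul hVpos.le,
      show 1 / α * -α = -1 by field_simp, Real.rpow_neg_one, hV, Real.exp_neg]
  have h2 : θ ^ 2 ≤ 2 * Real.exp θ := by
    linarith [Real.quadratic_le_exp_of_nonneg hθ]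
  have h3 : θ ^ 2 * Real.exp θ * (K * (ε ^ (-α) * Real.exp (-(2 * θ)))) ≤ 2 * K * ε ^ (-α) := by
    have h4 : Real.exp θ * Real.exp (-(2 * θ)) = Real.exp (-θ) := by
      rw [← Real.exp_add]; ring_nf
    have h5 : Real.exp θ * Real.exp (-θ) = 1 := by rw [← Real.exp_add]; simp
    calc θ ^ 2 * Real.exp θ * (K * (ε ^ (-α) * Real.exp (-(2 * θ))))
        = K * ε ^ (-α) * (θ ^ 2 * (Real.exp θ * Real.exp (-(2 * θ)))) := by ring
      _ ≤ K * ε ^ (-α) * ((2 * Real.exp θ) * Real.exp (-θ)) := by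
          rw [h4]; gcongr
      _ = 2 * K * ε ^ (-α) := by rw [mul_assoc 2, h5]; ring
  have h6 : Real.exp (-(2 * θ)) ^ 2 = Real.exp (-(4 * θ)) := by
    rw [sq, ← Real.exp_add]; ring_nf
  rw [h1]
  calc (k * (ε ^ (-α) * Real.exp (-(2 * θ)))) ^ 2 + 2 * Real.exp (-θ * 4 + θ ^ 2 * Real.exp θ *
        (K * (ε ^ (-α) * Real.exp (-(2 * θ)))))
      ≤ (k * (ε ^ (-α) * Real.exp (-(2 * θ)))) ^ 2 +
        2 * Real.exp (-θ * 4 + 2 * K * ε ^ (-α)) := by gcongr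
    _ = Real.exp (-(4 * θ)) * ((k * ε ^ (-α)) ^ 2 + 2 * Real.exp (2 * K * ε ^ (-α))) := by
        rw [Real.exp_add, show -θ * 4 = -(4 * θ) by ring, ← h6]; ring

theorem scaledMax_bounds [IsProbabilityMeasure μ] [IsProbabilityMeasure P]
    (hv : 0 < v) (hα : 0 < α) {k K : ℝ} (hk : 0 < k) (hK : 0 ≤ K)
    {ν : Measure ℝ} [SFinite ν] (hν : IsStableLevyMeasure α k K ν)
    (hfin : ∀ n, (orbitBall G o n).Finite) (hc : IsSignCocycle μ c)
    (hY : HasRosinskiRepresentation α μ c P Y) (n : ℕ) {x ε : ℝ} (hx : 0 < x) (hε : 0 < ε) :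
    P.real {ω | scaledMax o v α Y n ω < x} ≤
      Real.exp (-(k * (x + 4 * ε) ^ (-α) * (extremalCocycle G o v μ n).toReal)) +
        (orbitBall G o n).ncard * Real.exp (-(2 * v * n)) *
          ((k * ε ^ (-α)) ^ 2 + 2 * Real.exp (2 * K * ε ^ (-α))) ∧
    Real.exp (-(k * x ^ (-α) * (extremalCocycle G o v μ n).toReal)) ≤
      P.real {ω | scaledMax o v α Y n ω ≤ x + 4 * ε} +
        (orbitBall G o n).ncard * Real.exp (-(2 * v * n)) *
          ((k * ε ^ (-α)) ^ 2 + 2 * Real.exp (2 * K * ε ^ (-α))) := by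
  set s := (hfin n).toFinset with hs
  have hmem : ∀ g, g ∈ s ↔ g ∈ orbitBall G o n := fun g => (hfin n).mem_toFinset
  have hne : Nonempty s := ⟨⟨1, (hmem 1).2 (one_mem_orbitBall n)⟩⟩
  set V := volGrowth v n with hVdef
  have hV : 0 < V := Real.exp_pos _
  set W := V ^ (1 / α) with hW
  have hW0 : 0 < W := Real.rpow_pos_of_pos hV _
  have hWα : W ^ (-α) = V⁻¹ := by
    rw [hW, ← Real.rpow_mul hV.le, show 1 / α * -α = -1 by field_simp, Real.rpow_neg_one]
  have hcard : Fintype.card s = (orbitBall G o n).ncard := by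
    rw [Fintype.card_coe, Set.ncard_eq_toFinset_card _ (hfin n)]
  -- The levels `τ` and `a` are on the scale `W = V^{1/α}`, and `θ = v n / 2` makes `e^{2θ} = V`.
  have key := stable_max_bounds (P := P) (ι := s) hα hk hK hν
    (f := fun g => rosinskiKernel α μ c (g : G)) (Y := fun g => Y (g : G))
    (fun g => hc.measurable_rosinskiKernel (g : G))
    (fun g => hc.lintegral_rosinskiKernel_le hα (g : G))
    (fun t => hc.integrable_sum hα (fun g : s => (g : G)) t)
    (fun g => hY.aemeasurable (g : G)) (hY.charFun_sum hα s)
    (τ := ε * W) (θ := v * n / 2) (a := x * W) (by positivity) (by positivity) (by positivity)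
  rw [← hc.lintegral_maxCocycle hα hmem, hcard] at key
  have hC : (extremalCocycle G o v μ n).toReal = (∫⁻ ξ, maxCocycle G o μ n ξ ∂μ).toReal / V := by
    rw [extremalCocycle, ENNReal.toReal_div, ENNReal.toReal_ofReal hV.le]
  have hscale : ∀ y : ℝ, 0 < y → k * (y * W) ^ (-α) * (∫⁻ ξ, maxCocycle G o μ n ξ ∂μ).toReal =
      k * y ^ (-α) * (extremalCocycle G o v μ n).toReal := by
    intro y hy
    rw [Real.mul_rpow hy.le hW0.le, hWα, hC]
    field_simp
  have hxε : x * W + 4 * (ε * W) = (x + 4 * ε) * W := by ring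
  rw [hxε, hscale _ (by positivity), hscale _ hx] at key
  have hlt : {ω | ∀ g : s, |Y (g : G) ω| < x * W} = {ω | scaledMax o v α Y n ω < x} := by
    ext ω
    simp only [Set.mem_ofPred_eq, scaledMax_lt_iff hfin, ← hmem, Subtype.forall]
    rfl
  have hle : {ω | ∀ g : s, |Y (g : G) ω| ≤ (x + 4 * ε) * W} =
      {ω | scaledMax o v α Y n ω ≤ x + 4 * ε} := by
    ext ω
    simp only [Set.mem_ofPred_eq, scaledMax_le_iff hfin, ← hmem, Subtype.forall]
    rfl
  rw [hlt, hle] at key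
  have herr := stable_error_le (k := k) hK hε hα (θ := v * n / 2) (by positivity)
    (V := V) (by rw [hVdef, volGrowth]; ring_nf)
  rw [show 4 * (v * n / 2) = 2 * v * n by ring, ← hW] at herr
  have herr' := mul_le_mul_of_nonneg_left herr (Nat.cast_nonneg (α := ℝ) (orbitBall G o n).ncard)
  rw [← mul_assoc _ (Real.exp (-(2 * v * n)))] at herr'
  exact ⟨key.1.trans (by linarith), key.2.trans (by linarith)⟩

/-- The two boundary settings enter only through a uniform bound on `C_n`; everything else is common
to both. -/
theorem maximaDichotomy_of_bounded [IsProbabilityMeasure μ] [IsProbabilityMeasure P]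
    (hv : 0 < v) (hα : 0 < α) (hα₂ : α < 2)
    (hfin : ∀ n, (orbitBall G o n).Finite)
    (hcard : Tendsto (fun n : ℕ => (orbitBall G o n).ncard * Real.exp (-(2 * v * n))) atTop (𝓝 0))
    {D : ℝ≥0∞} (hD : D ≠ ∞) (hbdd : ∀ n, extremalCocycle G o v μ n ≤ D)
    (hc : IsSignCocycle μ c) (hY : HasRosinskiRepresentation α μ c P Y)
    {Ω' : Type*} [MeasurableSpace Ω'] {P' : Measure Ω'} [IsProbabilityMeasure P']
    {Z : Ω' → ℝ} (hZ : IsFrechet Z P' α) :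
    MaximaDichotomy G o v α μ P Y P' Z := by
  obtain ⟨k, K, ν, hk, hK, hsf, hν⟩ := exists_isStableLevyMeasure hα hα₂
  have hcdf : ∀ φ : ℕ → ℕ, Tendsto φ atTop atTop → ∀ L : ℝ≥0∞, L ≠ ∞ →
      Tendsto (fun j => extremalCocycle G o v μ (φ j)) atTop (𝓝 L) → ∀ x > 0,
      Tendsto (fun j => P.real {ω | scaledMax o v α Y (φ j) ω ≤ x}) atTop
        (𝓝 (Real.exp (-(k * x ^ (-α) * L.toReal)))) := by
    intro φ hφ L hL hlim x hx
    exact tendsto_cdf_of_bounds (hcard.comp hφ) ((ENNReal.tendsto_toReal hL).comp hlim)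
      (M := fun ε => (k * ε ^ (-α)) ^ 2 + 2 * Real.exp (2 * K * ε ^ (-α)))
      (fun j x hx ε hε => (scaledMax_bounds hv hα hk hK hν hfin hc hY (φ j) hx hε).1)
      (fun j x hx ε hε => (scaledMax_bounds hv hα hk hK hν hfin hc hY (φ j) hx hε).2) hx
  have hconv : NonvanishingECG G o v μ → ∀ φ : ℕ → ℕ, Tendsto φ atTop atTop → ∀ L : ℝ≥0∞,
      Tendsto (fun j => extremalCocycle G o v μ (φ j)) atTop (𝓝 L) → ∃ κ : ℝ, 0 < κ ∧
        TendstoInDistribution (fun j => scaledMax o v α Y (φ j)) atTop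
          (fun ω => κ * Z ω) (fun _ => P) P' := by
    intro hpos φ hφ L hlim
    have hL : L ≠ ∞ := ne_top_of_le_ne_top hD (le_of_tendsto' hlim fun j => hbdd _)
    -- A limit along `φ` is at least the liminf of the whole sequence.
    have hL0 : 0 < L := by
      refine hpos.trans_le ?_
      rw [← hlim.liminf_eq]
      exact liminf_le_liminf_of_le hφ
    have hLr : 0 < L.toReal := ENNReal.toReal_pos hL0.ne' hL
    refine ⟨(k * L.toReal) ^ (1 / α), by positivity, tendstoInDistribution_frechet hα hZ
      (by positivity) (fun j => hY.aemeasurable_scaledMax hfin _) fun x hx => ?_⟩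
    rw [← Real.rpow_mul (by positivity), one_div_mul_cancel hα.ne', Real.rpow_one,
      mul_right_comm]
    exact hcdf φ hφ L hL hlim x hx
  refine ⟨fun hpos => ⟨fun φ hφ => ?_, fun ⟨L, hL⟩ => hconv hpos id tendsto_id L hL⟩,
    fun hvan => ?_⟩
  -- Compactness of `[0, ∞]` provides the limit; its finiteness and positivity are established in
  -- `hconv`.
  · obtain ⟨L, ψ, hψ, hL⟩ := CompactSpace.tendsto_subseq
      fun j => extremalCocycle G o v μ (φ j)
    exact ⟨ψ, hψ, hconv hpos (fun j => φ (ψ j)) (hφ.comp hψ).tendsto_atTop L hL⟩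
  · refine tendstoInMeasure_zero_of_cdf (fun n ω => scaledMax_nonneg n ω)
      (fun n => hY.aemeasurable_scaledMax hfin n) fun x hx => ?_
    simpa using hcdf id tendsto_id 0 ENNReal.zero_ne_top hvan x hx

end Field

/-! ### Orbit counting and Busemann bounds -/

section Geometry

theorem HoroSpace.continuous_diff {X : Type*} [MetricSpace X] (p q : X) :
    Continuous fun η : HoroSpace X => η.diff p q :=
  HoroSpace.continuous_of_comp_mk ((ContinuousEvalConst.continuous_eval_const p).sub
    (ContinuousEvalConst.continuous_eval_const q))

theorem HoroBoundary.continuous_busemann {X : Type*} [MetricSpace X] (p q : X) :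
    Continuous fun ξ : HoroBoundary X => ξ.busemann p q :=
  (HoroSpace.continuous_diff p q).comp continuous_subtype_val

/-- The inequality is a closed condition and holds for `x ↦ d(x, ·)` by the triangle inequality, so
it passes to the closure. -/
theorem HoroBoundary.neg_dist_le_busemann {X : Type*} [MetricSpace X] (ξ : HoroBoundary X)
    (p q : X) : -dist p q ≤ ξ.busemann p q := by
  have hclosed : IsClosed {η : HoroSpace X | -dist p q ≤ η.diff p q} :=
    isClosed_le continuous_const (HoroSpace.continuous_diff p q)
  refine closure_minimal ?_ hclosed ξ.2.1
  rintro _ ⟨x, rfl⟩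
  change -dist p q ≤ dist x p - dist x q
  linarith [dist_triangle x p q]

theorem GromovBoundary.neg_dist_le_busemann {X : Type*} [MetricSpace X] (ξ : GromovBoundary X)
    (p q : X) : -dist p q ≤ ξ.busemann p q := by
  rw [GromovBoundary.busemann]
  -- Along the trivial filter the real limsup is `0` by convention, so the bound holds without
  -- showing that `ξ` is approached by points of `X`.
  rcases eq_or_neBot ξ.approach with h | h
  · rw [h, limsup, limsSup]
    simp
  · have hlow : ∀ z, -dist p q ≤ dist p z - dist q z := fun z => by
      linarith [dist_triangle q p z, dist_comm p q]
    have hup : ∀ z, dist p z - dist q z ≤ dist p q := fun z => by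
      linarith [dist_triangle p q z]
    exact le_limsup_of_frequently_le (Frequently.of_forall hlow)
      (isBoundedUnder_of ⟨_, hup⟩)

variable {G : Type*} [Group G] {X : Type*} [MetricSpace X] [MulAction G X] {o : X} {v : ℝ}

/-- Terms of a summable family tend to zero, whereas those indexed by `B_n` stay above `exp(-s n)`.
-/
theorem finite_orbitBall {s : ℝ} (hs : 0 ≤ s)
    (hsum : Summable fun g : G => Real.exp (-s * dist o (g • o))) (n : ℕ) :
    (orbitBall G o n).Finite := by
  have h := hsum.tendsto_cofinite_zero.eventually (gt_mem_nhds (Real.exp_pos (-s * n)))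
  refine Set.Finite.subset (eventually_cofinite.1 h) fun g hg => ?_
  have hg : dist o (g • o) ≤ n := hg
  simp only [Set.mem_ofPred_eq, not_lt, Real.exp_le_exp]
  nlinarith

theorem tendsto_ncard_orbitBall (hv : 0 < v)
    (hcrit : ∀ s : ℝ, v < s → Summable fun g : G => Real.exp (-s * dist o (g • o))) :
    Tendsto (fun n : ℕ => (orbitBall G o n).ncard * Real.exp (-(2 * v * n))) atTop (𝓝 0) := by
  -- Any exponent strictly between `v` and `2v` would do: convergence gives a cardinality
  -- `O(e^{sn})`.
  set s := 3 / 2 * v with hs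
  have hsum := hcrit s (by linarith)
  have hbound : ∀ n : ℕ, (orbitBall G o n).ncard * Real.exp (-s * n) ≤
      ∑' g : G, Real.exp (-s * dist o (g • o)) := by
    intro n
    have hfin := finite_orbitBall (by positivity) hsum n
    refine le_trans ?_ (hsum.sum_le_tsum hfin.toFinset fun g _ => (Real.exp_pos _).le)
    rw [Set.ncard_eq_toFinset_card _ hfin, ← nsmul_eq_mul]
    refine Finset.card_nsmul_le_sum _ _ _ fun g hg => ?_
    have hg : dist o (g • o) ≤ n := (hfin.mem_toFinset).1 hg
    rw [Real.exp_le_exp]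
    nlinarith
  have hlim : Tendsto (fun n : ℕ => (∑' g : G, Real.exp (-s * dist o (g • o))) *
      Real.exp (-(v / 2 * n))) atTop (𝓝 0) := by
    have := (Real.tendsto_exp_neg_atTop_nhds_zero.comp
      (tendsto_natCast_atTop_atTop.const_mul_atTop (half_pos hv))).const_mul
      (∑' g : G, Real.exp (-s * dist o (g • o)))
    simpa using this
  refine squeeze_zero (fun n => by positivity) (fun n => ?_) hlim
  rw [show -(2 * v * n) = -s * n + -(v / 2 * n) by rw [hs]; ring, Real.exp_add, ← mul_assoc]
  gcongr
  exact hbound n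

/-- Finiteness of `B_n` combines the almost-everywhere bounds into one on the maximum; `μ` has mass
one. -/
theorem extremalCocycle_le {Λ : Type*} [MeasurableSpace Λ] [MulAction G Λ] {μ : Measure Λ}
    [IsProbabilityMeasure μ] {n : ℕ} (hfin : (orbitBall G o n).Finite) {D : ℝ} (hD : 0 ≤ D)
    (h : ∀ g ∈ orbitBall G o n, ∀ᵐ ξ ∂μ,
      (μ.map (g • ·)).rnDeriv μ ξ ≤ ENNReal.ofReal (D * Real.exp (v * n))) :
    extremalCocycle G o v μ n ≤ ENNReal.ofReal D := by
  have hV : 0 < volGrowth v n := Real.exp_pos _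
  refine ENNReal.div_le_of_le_mul ?_
  rw [← ENNReal.ofReal_mul hD]
  have hae : ∀ᵐ ξ ∂μ, maxCocycle G o μ n ξ ≤ ENNReal.ofReal (D * volGrowth v n) := by
    filter_upwards [(ae_ball_iff hfin.countable).2 h] with ξ hξ
    exact iSup₂_le hξ
  refine (lintegral_mono_ae hae).trans ?_
  simp

end Geometry

/-! ### The two boundary settings -/

theorem theorem2p3
    {X : Type*} [MetricSpace X] [ProperSpace X] (hX : IsGeodesicSpace X)
    {G : Type*} [Group G] [MulAction G X] [IsIsometricSMul G X] [ProperlyDiscontinuousSMul G X]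
    (o : X) (v : ℝ) (hv : 0 < v)
    -- `v` is at least the critical exponent of the Poincaré series
    (hcrit : ∀ s : ℝ, v < s → Summable fun g : G => Real.exp (-s * dist o (g • o)))
    (α : ℝ) (hα₀ : 0 < α) (hα₂ : α < 2)
    {Ω : Type*} [MeasurableSpace Ω] (P : Measure Ω) [IsProbabilityMeasure P] (Y : G → Ω → ℝ)
    {Ω' : Type*} [MeasurableSpace Ω'] (P' : Measure Ω') [IsProbabilityMeasure P']
    (Z : Ω' → ℝ) (hZ : IsFrechet Z P' α) :
    -- conformal densities on the horofunction boundary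
    (∀ (μ : X → FiniteMeasure (HoroBoundary X)) (c : G → HoroBoundary X → ℝ),
      IsConformalDensity G o v μ →
      IsProbabilityMeasure (μ o : Measure (HoroBoundary X)) →
      IsSignCocycle (μ o : Measure (HoroBoundary X)) c →
      HasRosinskiRepresentation α (μ o : Measure (HoroBoundary X)) c P Y →
      MaximaDichotomy G o v α (μ o : Measure (HoroBoundary X)) P Y P' Z) ∧
    -- quasiconformal densities on the Gromov boundary
    (IsGromovHyperbolic X →
      ∀ (C : ℝ) (μ : X → FiniteMeasure (GromovBoundary X)) (c : G → GromovBoundary X → ℝ),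
      1 ≤ C →
      IsQuasiconformalDensity G v C μ →
      IsProbabilityMeasure (μ o : Measure (GromovBoundary X)) →
      IsSignCocycle (μ o : Measure (GromovBoundary X)) c →
      HasRosinskiRepresentation α (μ o : Measure (GromovBoundary X)) c P Y →
      MaximaDichotomy G o v α (μ o : Measure (GromovBoundary X)) P Y P' Z) := by

  have hfin : ∀ n, (orbitBall G o n).Finite :=
    finite_orbitBall (s := v + 1) (by linarith) (hcrit (v + 1) (by linarith))
  have hcard := tendsto_ncard_orbitBall hv hcrit
  have hexp : ∀ {b : ℝ} {n : ℕ} {g : G}, g ∈ orbitBall G o n → -dist (g • o) o ≤ b →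
      Real.exp (-v * b) ≤ Real.exp (v * n) := by
    intro b n g hg hb
    have hg : dist o (g • o) ≤ n := hg
    rw [dist_comm] at hb
    rw [Real.exp_le_exp]
    nlinarith
  constructor
  · intro μ c hμ hprob hc hY
    refine maximaDichotomy_of_bounded hv hα₀ hα₂ hfin hcard (D := ENNReal.ofReal 1)
      ENNReal.ofReal_ne_top (fun n => extremalCocycle_le (hfin n) zero_le_one fun g hg => ?_)
      hc hY hZ
    -- Equivariance identifies `g_* μ_o` with `μ_{g o}`, whose density is `exp(-v β) ≤ exp(v d(g o,
    -- o)) ≤ V_n`. In the quasiconformal case the only change is the factor `C`.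
    rw [← hμ.equivariant, hμ.density]
    have hmeas : Measurable fun ξ : HoroBoundary X =>
        ENNReal.ofReal (Real.exp (-v * ξ.busemann (g • o) o)) :=
      (ENNReal.continuous_ofReal.comp (Real.continuous_exp.comp
        (continuous_const.mul (HoroBoundary.continuous_busemann (g • o) o)))).measurable
    filter_upwards [Measure.rnDeriv_withDensity (μ o : Measure (HoroBoundary X)) hmeas] with ξ hξ
    rw [hξ, one_mul]
    exact ENNReal.ofReal_le_ofReal (hexp hg (ξ.neg_dist_le_busemann _ _))
  · intro _ C μ c hC hμ hprob hc hY
    refine maximaDichotomy_of_bounded hv hα₀ hα₂ hfin hcard (D := ENNReal.ofReal C)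
      ENNReal.ofReal_ne_top
      (fun n => extremalCocycle_le (hfin n) (zero_le_one.trans hC) fun g hg => ?_) hc hY hZ
    rw [← hμ.equivariant]
    filter_upwards [hμ.density (g • o) o] with ξ hξ
    refine hξ.2.trans (ENNReal.ofReal_le_ofReal ?_)
    exact mul_le_mul_of_nonneg_left (hexp hg (ξ.neg_dist_le_busemann _ _)) (zero_le_one.trans hC)
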